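/- **Setting.** Let $n,l\ge 0$ be integers, $\mathbb T\subseteq\mathbb R$ a nonempty open interval, $\Omega\subseteq\mathbb R^{(l+1)n}$ a nonempty open set with coordinates $(x,\dot x,\dots,x^{(l)})$, $x^{(k)}=(x^{(k)}_j)_{j\in C}$, and $F=(F_i)_{i\in R}:\mathbb T\times\Omega\to\mathbb R^n$ real analytic, $|R|=|C|=n$. Consider the differential-algebraic equation (DAE) $F(t,x(t),\dot x(t),\dots,x^{(l)}(t))=0$. For a function $f$ on a domain $\mathbb T\times\Omega$, $\operatorname{ord}_{x_j}f$ is the largest $k$ such that $\partial f/\partial x_j^{(k)}$ is not identically zero on the domain, and $-\infty$ if there is none. The formal derivative of $f$ is $\dot f=\partial f/\partial t+\sum_{k}\sum_j(\partial f/\partial x_j^{(k)})\,x_j^{(k+1)}$, and $f^{(d)}$, its $d$-fold iterate, is defined on $\mathbb T\times\Omega^{(d)}$, $\Omega^{(d)}=\Omega\times\mathbb R^{dn}$. $G(F)$ is the bipartite graph on $R\cup C$ with an edge $(i,j)$ whenever $\operatorname{ord}_{x_j}F_i>-\infty$. The dual problem $D(F)$ is to minimize $\sum_j q_j-\sum_i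 p_i$ over $p\in\mathbb Z^R$, $q\in\mathbb Z^C$ with $q_j-p_i\ge\operatorname{ord}_{x_j}F_i$ for all edges $(i,j)$; $\hat\delta(F)$ is its optimal value, and $-\infty$ if there is no optimal solution. For feasible $(p,q)$ the system Jacobian is the matrix $D$ with entries $D_{i,j}=\partial F_i/\partial x_j^{(q_j-p_i)}$ (zero if $q_j-p_i<0$ or $q_j-p_i>l$). A matrix of functions is identically singular if it is singular at every point of the domain. A point $(t^*,X^*)\in\mathbb T\times\Omega$ is consistent if some $C^\infty$ solution $x$ of the DAE on an open interval around $t^*$ satisfies $(x(t^*),\dots,x^{(l)}(t^*))=X^*$. **Assumptions.** (I1) $G(F)$ has a perfect matching. For the optimal solution $(p,q)$ of $D(F)$ used below: (I2) every square submatrix $D[I,J]$ of $D$ that is not identically singular on $\mathbb T\times\Omega$ is nonsingular at some consistent point; (I3) $D$ is identically singular. **The substitution method.** Given an optimal solution $(p,q)$ of $D(F)$: 1. Choose $r\in R$, $I\subseteq R\setminus\{r\}$ and $J\subseteq C$ with $|I|=|J|=m$ such that $D[I,J]$ is not identically singular, the maximum size of a square submatrix of $D[I\cup\{r\},C]$ that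 is not identically singular is $m$, and $p_r\le p_i$ for $i\in I$. Put $\kappa=\max_{i\in I}p_i-p_r$. 2. Choose a point $(\hat t,\hat X)\in\mathbb T\times\Omega^{(\kappa)}$ at which $F_I^{(p-p_r)}=(F_i^{(p_i-p_r)})_{i\in I}$ vanishes and its Jacobian matrix with respect to $x_J^{(q-p_r)}=(x_j^{(q_j-p_r)})_{j\in J}$ is nonsingular. 3. Splitting $X=(x,\dots,x^{(l+\kappa)})$ into $y=x_J^{(q-p_r)}$ and the remaining coordinates $v$, choose as in the implicit function theorem an open interval $\bar{\mathbb T}\subseteq\mathbb T$ and open sets $V$, $W$ with $V\times W\subseteq\Omega^{(\kappa)}$ and $(\hat t,\hat X)\in\bar{\mathbb T}\times(V\times W)$, and a real analytic $\phi:\bar{\mathbb T}\times V\to W$ that takes the value $\hat y$ at $(\hat t,\hat v)$, where $\hat X=(\hat v,\hat y)$, such that for $(t,v,y)\in\bar{\mathbb T}\times V\times W$ one has $F_I^{(p-p_r)}(t,v,y)=0$ if and only if $y=\phi(t,v)$, and the Jacobian matrix of $F_I^{(p-p_r)}$ with respect to $y$ is nonsingular at $(t,v,\phi(t,v))$ for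 all $(t,v)\in\bar{\mathbb T}\times V$. 4. Output $\bar F$ on $\bar{\mathbb T}\times\bar\Omega$, $\bar\Omega=V\times W\subseteq\Omega^{(\kappa)}$, where $\bar F_i=F_i$ for $i\ne r$ and $\bar F_r$ is $F_r$ with $\phi(t,v)$ substituted for $x_J^{(q-p_r)}$. **Theorem.** Assume (I1). Then $D(F)$ has an optimal solution $(p,q)$ with $0\le p_i\le nl$ and $0\le q_j\le nl$ for all $i,j$. Let $(p,q)$ be any optimal solution of $D(F)$ for which (I2) and (I3) hold. Then the choices in Steps 1, 2 and 3 are always possible (whatever was chosen in the earlier steps), and for all choices the output $\bar F$ has the following properties. * (S1) $\bar F$ is real analytic on $\bar{\mathbb T}\times\bar\Omega\subseteq\mathbb T\times\Omega^{(\kappa)}$, where $\bar{\mathbb T}$ is a nonempty open interval and $\bar\Omega$ is nonempty and open; and $\kappa\le ln$ if $0\le p_i,q_j\le nl$ for all $i,j$. * (S2) $\bar F=0$ is locally equivalent to $F=0$: for every $(t^*,X^*)\in\bar{\mathbb T}\times\bar\Omega$ and every trajectory $x:\bar{\mathbb T}\to\mathbb R^n$ of class $C^{l+\kappa}$ with $(x(t^*),\dots,x^{(l+\kappa)}(t^*))=X^*$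 there is an open interval $\mathbb I_0\subseteq\bar{\mathbb T}$ containing $t^*$ such that for every open interval $\mathbb I\subseteq\mathbb I_0$ containing $t^*$ (in particular for $\mathbb I=\mathbb I_0$), $x$ is a solution of $F=0$ on $\mathbb I$ if and only if $x$ is a solution of $\bar F=0$ on $\mathbb I$. * (S3) $\hat\delta(\bar F)\le\hat\delta(F)-1$. -/

import Mathlib

open Set Topology
open scoped ContDiff

noncomputable section

namespace DAE

/-! ### Jet coordinates and functions of them -/

/-- The space `ℝ^{(m+1)n}` with coordinates `(x, ẋ, …, x^{(m)})`; the entry `X k j` is the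
coordinate `x_j^{(k)}`. -/
abbrev Jet (n m : ℕ) : Type := Fin (m + 1) → Fin n → ℝ

/-- Forget the coordinates of order larger than `m`. -/
def trunc {n m M : ℕ} (h : m ≤ M) (X : Jet n M) : Jet n m :=
  fun k => X (Fin.castLE (Nat.add_le_add_right h 1) k)

/-- The open set `Ω^{(d)} = Ω × ℝ^{dn}`. -/
def prolong {n l : ℕ} (Ω : Set (Jet n l)) (d : ℕ) : Set (Jet n (l + d)) :=
  {X | trunc (Nat.le_add_right l d) X ∈ Ω}

/-- The partial derivative `∂f/∂x_j^{(k)}` for an integer `k`; it is the zero function when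
`x_j^{(k)}` is not one of the arguments of `f` (that is, when `k < 0` or `k > m`). -/
def pderivX {n m : ℕ} (f : ℝ × Jet n m → ℝ) (j : Fin n) (k : ℤ) (z : ℝ × Jet n m) : ℝ :=
  if h : 0 ≤ k ∧ k ≤ m then
    fderiv ℝ f z (0, Pi.single (⟨k.toNat, by omega⟩ : Fin (m + 1)) (Pi.single j 1))
  else 0

/-- The partial derivative `∂f/∂t`. -/
def pderivT {n m : ℕ} (f : ℝ × Jet n m → ℝ) (z : ℝ × Jet n m) : ℝ :=
  fderiv ℝ f z (1, 0)

/-- The formal derivative `ḟ = ∂f/∂t + ∑_{k ≤ m} ∑_j ∂f/∂x_j^{(k)} · x_j^{(k+1)}`. -/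
def totalDeriv {n m : ℕ} (f : ℝ × Jet n m → ℝ) : ℝ × Jet n (m + 1) → ℝ :=
  fun z =>
    pderivT f (z.1, trunc (Nat.le_succ m) z.2) +
      ∑ k : Fin (m + 1), ∑ j : Fin n,
        pderivX f j ((k : ℕ) : ℤ) (z.1, trunc (Nat.le_succ m) z.2) * z.2 k.succ j

/-- The formal derivative `f^{(d)}` of order `d`. -/
def iterTotalDeriv {n l : ℕ} (f : ℝ × Jet n l → ℝ) : (d : ℕ) → ℝ × Jet n (l + d) → ℝ
  | 0 => f
  | d + 1 => totalDeriv (iterTotalDeriv f d)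

/-- The formal derivative `f^{(d)}` regarded as a function of `(t, x, …, x^{(l+κ)})`, `d ≤ κ`. -/
def iterTotalDerivLift {n l : ℕ} (f : ℝ × Jet n l → ℝ) (d κ : ℕ) (h : d ≤ κ) :
    ℝ × Jet n (l + κ) → ℝ :=
  fun z => iterTotalDeriv f d (z.1, trunc (Nat.add_le_add_left h l) z.2)

/-- On the domain `S`, the function `f` depends on `x_j^{(k)}`. -/
def DependsOn {n m : ℕ} (S : Set (ℝ × Jet n m)) (f : ℝ × Jet n m → ℝ) (j : Fin n) (k : ℕ) : Prop :=
  ∃ z ∈ S, pderivX f j (k : ℤ) z ≠ 0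

open Classical in
/-- The maximal order `k` such that `f` depends on `x_j^{(k)}` on the domain `S`; it is `⊥`
(that is, `-∞`) if there is none. -/
def ord {n m : ℕ} (S : Set (ℝ × Jet n m)) (f : ℝ × Jet n m → ℝ) (j : Fin n) : WithBot ℕ :=
  (Finset.univ.filter (fun k : Fin (m + 1) => DependsOn S f j k)).sup
    (fun k => ((k : ℕ) : WithBot ℕ))

/-! ### The assignment problem -/

section Assignment

variable {n m : ℕ} (S : Set (ℝ × Jet n m)) (F : ℝ × Jet n m → Fin n → ℝ)

/-- The bipartite graph with an edge `(i, j)` whenever `ord F_i x_j > -∞` has a perfect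
matching. -/
def HasPerfectMatching : Prop :=
  ∃ σ : Equiv.Perm (Fin n), ∀ i, ord S (fun z => F z i) (σ i) ≠ ⊥

/-- Dual feasibility: `q_j - p_i ≥ ord F_i x_j` for every edge `(i, j)`. -/
def DualFeasible (p q : Fin n → ℤ) : Prop :=
  ∀ i j, ∀ c : ℕ, ord S (fun z => F z i) j = (c : WithBot ℕ) → (c : ℤ) ≤ q j - p i

/-- The dual objective function. -/
def dualValue (p q : Fin n → ℤ) : ℤ := ∑ j, q j - ∑ i, p i

/-- `(p, q)` is an optimal solution of the dual problem. -/
def DualOptimal (p q : Fin n → ℤ) : Prop :=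
  DualFeasible S F p q ∧ ∀ p' q', DualFeasible S F p' q' → dualValue p q ≤ dualValue p' q'

open Classical in
/-- The optimal value of the dual problem, and `⊥` (that is, `-∞`) if there is no optimal
solution. -/
def optValue : WithBot ℤ :=
  if h : ∃ pq : (Fin n → ℤ) × (Fin n → ℤ), DualOptimal S F pq.1 pq.2 then
    ((dualValue h.choose.1 h.choose.2 : ℤ) : WithBot ℤ)
  else ⊥

/-- The system Jacobian `D_{i,j} = ∂F_i/∂x_j^{(q_j - p_i)}`. -/
def systemJacobian (p q : Fin n → ℤ) (z : ℝ × Jet n m) : Matrix (Fin n) (Fin n) ℝ :=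
  Matrix.of fun i j => pderivX (fun w => F w i) j (q j - p i) z

end Assignment

/-- A square matrix, with rows and columns indexed by possibly different types, is nonsingular. -/
def IsNonsingular {ι ι' : Type} [Fintype ι] [Fintype ι'] [DecidableEq ι] [DecidableEq ι']
    (A : Matrix ι ι' ℝ) : Prop :=
  ∃ B : Matrix ι' ι ℝ, A * B = 1 ∧ B * A = 1

/-- The submatrix `A[I, J]`. -/
def sub {n : ℕ} (A : Matrix (Fin n) (Fin n) ℝ) (I J : Finset (Fin n)) : Matrix I J ℝ :=
  A.submatrix (fun i => (i : Fin n)) (fun j => (j : Fin n))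

/-- `D[I, J]` is a square matrix that is not identically singular on `S`. -/
def NotIdenticallySingular {n m : ℕ} (S : Set (ℝ × Jet n m))
    (D : ℝ × Jet n m → Matrix (Fin n) (Fin n) ℝ) (I J : Finset (Fin n)) : Prop :=
  ∃ z ∈ S, IsNonsingular (sub (D z) I J)

/-! ### Solutions and consistent points -/

/-- The vector `(x(t), ẋ(t), …, x^{(m)}(t))`. -/
def jet {n : ℕ} (m : ℕ) (x : ℝ → Fin n → ℝ) (t : ℝ) : Jet n m :=
  fun k => iteratedDeriv k x t

/-- `x` satisfies `F(t, x(t), …, x^{(m)}(t)) = 0` at every `t ∈ 𝕀`, where `F` has the domain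
`S`. -/
def SolvesOn {n m : ℕ} (S : Set (ℝ × Jet n m)) (F : ℝ × Jet n m → Fin n → ℝ)
    (x : ℝ → Fin n → ℝ) (𝕀 : Set ℝ) : Prop :=
  ∀ t ∈ 𝕀, (t, jet m x t) ∈ S ∧ F (t, jet m x t) = 0

/-- `𝕀` is an open interval. -/
def IsOpenInterval (𝕀 : Set ℝ) : Prop := IsOpen 𝕀 ∧ 𝕀.OrdConnected

/-- `z = (t*, X*)` is a consistent point: a smooth solution, defined on an open interval around
`t*`, passes through it. -/
def IsConsistentPoint {n m : ℕ} (S : Set (ℝ × Jet n m)) (F : ℝ × Jet n m → Fin n → ℝ)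
    (z : ℝ × Jet n m) : Prop :=
  ∃ (𝕀 : Set ℝ) (x : ℝ → Fin n → ℝ), IsOpenInterval 𝕀 ∧ z.1 ∈ 𝕀 ∧ ContDiffOn ℝ ∞ x 𝕀 ∧
    SolvesOn S F x 𝕀 ∧ jet m x z.1 = z.2

/-- Every square submatrix of the system Jacobian that is not identically singular is nonsingular
at some consistent point. -/
def ConsistencyAssumption {n m : ℕ} (S : Set (ℝ × Jet n m)) (F : ℝ × Jet n m → Fin n → ℝ)
    (p q : Fin n → ℤ) : Prop :=
  ∀ I J : Finset (Fin n), NotIdenticallySingular S (systemJacobian F p q) I J →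
    ∃ z, IsConsistentPoint S F z ∧ IsNonsingular (sub (systemJacobian F p q z) I J)

/-! ### The substitution method -/

section Substitution

variable {n l : ℕ} (T : Set ℝ) (Ω : Set (Jet n l)) (F : ℝ × Jet n l → Fin n → ℝ)
variable (p q : Fin n → ℤ) (r : Fin n) (I J : Finset (Fin n))

/-- The conditions on the triple `(r, I, J)`, with `D` the system Jacobian and `m = |I| = |J|`:
`D[I, J]` is not identically singular; the maximum size of a submatrix of `D[I ∪ {r}, C]` that is
not identically singular is `m`; and `p_r ≤ p_i` for all `i ∈ I`. -/
structure IsAdmissibleTriple : Prop where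
  not_mem : r ∉ I
  card_eq : I.card = J.card
  nonsingular : NotIdenticallySingular (T ×ˢ Ω) (systemJacobian F p q) I J
  rank_eq : IsGreatest
    {k | ∃ I' J' : Finset (Fin n), I' ⊆ insert r I ∧ I'.card = k ∧
      NotIdenticallySingular (T ×ˢ Ω) (systemJacobian F p q) I' J'} I.card
  le : ∀ i ∈ I, p r ≤ p i

/-- The number `κ = max_{i ∈ I} p_i - p_r` (used only when `p_r ≤ p_i` for all `i ∈ I`). -/
def kappa : ℕ := I.sup fun i => (p i - p r).toNat

theorem le_kappa (i : I) : (p i - p r).toNat ≤ kappa p r I :=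
  Finset.le_sup (f := fun i => (p i - p r).toNat) i.2

/-- The functions `F_i^{(p_i - p_r)}`, `i ∈ I`, in the variables `(t, x, …, x^{(l+κ)})`. -/
def diffI (i : I) : ℝ × Jet n (l + kappa p r I) → ℝ :=
  iterTotalDerivLift (fun z => F z i) (p i - p r).toNat (kappa p r I) (le_kappa p r I i)

/-- The Jacobian matrix of `F_I^{(p - p_r)}` with respect to `x_J^{(q - p_r)}`. -/
def jacobianIJ (z : ℝ × Jet n (l + kappa p r I)) : Matrix I J ℝ :=
  Matrix.of fun i j => pderivX (diffI F p r I i) j (q j - p r) z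

/-- A point of `T × Ω^{(κ)}` at which `F_I^{(p - p_r)}` vanishes and its Jacobian matrix with
respect to `x_J^{(q - p_r)}` is nonsingular. -/
def IsBasePoint (z : ℝ × Jet n (l + kappa p r I)) : Prop :=
  z ∈ T ×ˢ prolong Ω (kappa p r I) ∧ (∀ i : I, diffI F p r I i z = 0) ∧
    IsNonsingular (jacobianIJ F p q r I J z)

/-- The coordinate `x_j^{(k)}` (with `kj = (k, j)`) is one of the entries of `x_J^{(q - p_r)}`. -/
def IsSolvedCoord {M : ℕ} (kj : Fin (M + 1) × Fin n) : Prop :=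
  kj.2 ∈ J ∧ ((kj.1 : ℕ) : ℤ) = q kj.2 - p r

instance {M : ℕ} : DecidablePred (IsSolvedCoord (M := M) p q r J) :=
  fun kj => inferInstanceAs (Decidable (kj.2 ∈ J ∧ ((kj.1 : ℕ) : ℤ) = q kj.2 - p r))

/-- The coordinates of `(x, …, x^{(M)})` other than the entries of `x_J^{(q - p_r)}`. -/
abbrev Rest (M : ℕ) : Type := {kj : Fin (M + 1) × Fin n // ¬ IsSolvedCoord p q r J kj} → ℝ

/-- Drop the entries of `x_J^{(q - p_r)}` from `X`. -/
def rest {M : ℕ} (X : Jet n M) : Rest p q r J M := fun kj => X kj.1.1 kj.1.2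

/-- The point whose coordinates `x_J^{(q - p_r)}` are `y` and whose remaining coordinates are
`v`. -/
def merge {M : ℕ} (v : Rest p q r J M) (y : J → ℝ) : Jet n M :=
  fun k j => if h : IsSolvedCoord p q r J (k, j) then y ⟨j, h.1⟩ else v ⟨(k, j), h⟩

variable (T' : Set ℝ) (V : Set (Rest p q r J (l + kappa p r I))) (W : Set (J → ℝ))
variable (φ : ℝ × Rest p q r J (l + kappa p r I) → J → ℝ)

/-- The domain `V × W` regarded as a set of points `(x, …, x^{(l+κ)})`. -/
def outDomain : Set (Jet n (l + kappa p r I)) :=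
  {X | ∃ v ∈ V, ∃ y ∈ W, X = merge p q r J v y}

/-- `φ : T' × V → W` is an explicit function for the equation `F_I^{(p - p_r)} = 0`, solved for
`x_J^{(q - p_r)}` around the point `z`, as provided by the implicit function theorem. -/
structure IsExplicitFunction (z : ℝ × Jet n (l + kappa p r I)) : Prop where
  interval : IsOpenInterval T'
  isOpen_V : IsOpen V
  isOpen_W : IsOpen W
  subset_T : T' ⊆ T
  subset_Ω : outDomain p q r I J V W ⊆ prolong Ω (kappa p r I)
  mem_T : z.1 ∈ T'
  mem_V : rest p q r J z.2 ∈ V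
  mem_W : φ (z.1, rest p q r J z.2) ∈ W
  base : merge p q r J (rest p q r J z.2) (φ (z.1, rest p q r J z.2)) = z.2
  analytic : AnalyticOnNhd ℝ φ (T' ×ˢ V)
  mapsTo : MapsTo φ (T' ×ˢ V) W
  zero_iff : ∀ t ∈ T', ∀ v ∈ V, ∀ y ∈ W,
    (∀ i : I, diffI F p r I i (t, merge p q r J v y) = 0) ↔ y = φ (t, v)
  nonsingular : ∀ t ∈ T', ∀ v ∈ V,
    IsNonsingular (jacobianIJ F p q r I J (t, merge p q r J v (φ (t, v))))

/-- The output of the substitution method: in `F_r`, the variables `x_J^{(q - p_r)}` are replaced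
by `φ`; the other equations are kept. -/
def output (z : ℝ × Jet n (l + kappa p r I)) : Fin n → ℝ := fun i =>
  if i = r then
    F (z.1, trunc (Nat.le_add_right l _)
      (merge p q r J (rest p q r J z.2) (φ (z.1, rest p q r J z.2)))) r
  else F (z.1, trunc (Nat.le_add_right l _) z.2) i

end Substitution

/-- Local equivalence, on the output domain `T' × Ω'`, of the order-`l` system `F = 0` with domain
`T × Ω` and the order-`(l+κ)` system `F' = 0` with domain `T' × Ω'`: for every trajectory
`x : T' → ℝⁿ` of class `C^{l+κ}` that passes through a point `(t₀, X₀)` of `T' × Ω'`, there is an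
open interval `𝕀₀ ⊆ T'` around `t₀` such that, on every open interval `𝕀 ⊆ 𝕀₀` around `t₀`
(in particular on `𝕀₀`), `x` solves the one system if and only if it solves the other. -/
def LocallyEquivalent {n l κ : ℕ} (T : Set ℝ) (Ω : Set (Jet n l)) (F : ℝ × Jet n l → Fin n → ℝ)
    (T' : Set ℝ) (Ω' : Set (Jet n (l + κ))) (F' : ℝ × Jet n (l + κ) → Fin n → ℝ) : Prop :=
  ∀ t₀ ∈ T', ∀ X₀ ∈ Ω', ∀ x : ℝ → Fin n → ℝ,
    ContDiffOn ℝ ((l + κ : ℕ) : WithTop ℕ∞) x T' → jet (l + κ) x t₀ = X₀ →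
    ∃ 𝕀₀ : Set ℝ, IsOpenInterval 𝕀₀ ∧ t₀ ∈ 𝕀₀ ∧ 𝕀₀ ⊆ T' ∧
      ∀ 𝕀 : Set ℝ, IsOpenInterval 𝕀 → t₀ ∈ 𝕀 → 𝕀 ⊆ 𝕀₀ →
        (SolvesOn (T ×ˢ Ω) F x 𝕀 ↔ SolvesOn (T' ×ˢ Ω') F' x 𝕀)

end DAE

end

/-!
The dual problem has an optimal solution because its objective, summed along a perfect matching,
is bounded below. Among the optimal solutions with `p ≥ 0`, one with the smallest `∑ p_i` has no
`p_i` beyond a gap longer than `l` (`DualOptimal.lower`), which bounds its entries by `n l`.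

The substitution method rests on two facts. The first is Griewank's lemma
(`pderivX_iterTotalDeriv`): above the order of `f` in `x_j`, formal differentiation only shifts the
partial derivatives, `∂f^{(d)}/∂x_j^{(k+d)} = ∂f/∂x_j^{(k)}`. By dual feasibility, the Jacobian
matrix of `F_I^{(p - p_r)}` with respect to `x_J^{(q - p_r)}` is therefore `D[I, J]`
(`jacobianIJ_eq`), and these equations depend on no `x_j^{(k)}` with `k > q_j - p_r`. A consistent
point at which `D[I, J]` is nonsingular thus provides a base point, and the analytic implicit
function theorem provides `φ`.

The second fact is that row `r` of `D` is a combination of the rows in `I` wherever `D[I, J]` is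
nonsingular, since the minors of size `|I| + 1` vanish (`exists_row_combination`). Let `P` be the
substitution of `φ` for `x_J^{(q - p_r)}`. The derivatives of `F_r` at `P` in the directions
`x_j^{(k)}`, `k ≥ q_j - p_r`, are the same combination of those of `F_I^{(p - p_r)}`, and
`F_I^{(p - p_r)} ∘ P` vanishes identically; so `F_r ∘ P` does not depend on these variables
(`IsExplicitFunction.pderivX_output_eq_zero`). Hence `p_r` can be raised by one without losing
feasibility for the output system, which lowers the dual objective by one.

For the local equivalence, either system contains the equations `F_i = 0`, `i ∈ I`. Along a
trajectory these imply `F_I^{(p - p_r)} = 0`, that is, `x_J^{(q - p_r)} = φ`, so that the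
substitution changes nothing.
-/

namespace DAE

/-! ### Coordinate directions and linear maps between jet spaces -/

/-- The unit vector in the direction of the coordinate `x_j^{(k)}`, and zero when `k < 0` or
`k > m`. -/
def coordVec {n : ℕ} (m : ℕ) (j : Fin n) (k : ℤ) : Jet n m :=
  fun a b => if ((a : ℕ) : ℤ) = k ∧ b = j then 1 else 0

/-- Forgetting the coordinates of order larger than `m`, as a linear map on points `(t, X)`. -/
noncomputable def truncL {n m M : ℕ} (h : m ≤ M) : ℝ × Jet n M →L[ℝ] ℝ × Jet n m :=
  (ContinuousLinearMap.fst ℝ ℝ (Jet n M)).prod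
    ((ContinuousLinearMap.pi fun k => ContinuousLinearMap.proj
      (Fin.castLE (Nat.add_le_add_right h 1) k)).comp (ContinuousLinearMap.snd ℝ ℝ (Jet n M)))

@[simp] theorem truncL_apply {n m M : ℕ} (h : m ≤ M) (z : ℝ × Jet n M) :
    truncL h z = (z.1, trunc h z.2) := rfl

/-- The shift `X ↦ (ẋ, …, x^{(m+1)})`. -/
noncomputable def shiftL (n m : ℕ) : Jet n (m + 1) →L[ℝ] Jet n m :=
  ContinuousLinearMap.pi fun k => ContinuousLinearMap.proj k.succ

@[simp] theorem shiftL_apply {n m : ℕ} (X : Jet n (m + 1)) (k : Fin (m + 1)) :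
    shiftL n m X k = X k.succ := rfl

theorem trunc_coordVec {n m M : ℕ} (h : m ≤ M) (j : Fin n) (k : ℤ) :
    trunc h (coordVec M j k) = coordVec m j k := by
  ext a b
  simp [trunc, coordVec]

theorem shiftL_coordVec {n m : ℕ} (j : Fin n) (k : ℤ) :
    shiftL n m (coordVec (m + 1) j (k + 1)) = coordVec m j k := by
  ext a b
  simp [coordVec]

theorem pderivX_eq_fderiv {n m : ℕ} (f : ℝ × Jet n m → ℝ) (j : Fin n) (k : ℤ)
    (z : ℝ × Jet n m) : pderivX f j k z = fderiv ℝ f z (0, coordVec m j k) := by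
  unfold pderivX
  split_ifs with h
  · congr 2
    ext a b
    simp only [coordVec, Pi.single_apply, Fin.ext_iff]
    by_cases ha : (a : ℕ) = k.toNat
    · have : ((a : ℕ) : ℤ) = k := by omega
      rw [if_pos ha]
      simp [this, Pi.single_apply, Fin.ext_iff]
    · have : ¬ ((a : ℕ) : ℤ) = k := by omega
      rw [if_neg ha]
      simp [this]
  · have : coordVec m j k = 0 := by
      ext a b
      have : ¬ ((a : ℕ) : ℤ) = k := by omega
      simp [coordVec, this]
    rw [this, Prod.mk_zero_zero, map_zero]

theorem jet_eq_sum_coordVec {n m : ℕ} (X : Jet n m) :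
    X = ∑ k : Fin (m + 1), ∑ j : Fin n, X k j • coordVec m j ((k : ℕ) : ℤ) := by
  ext a b
  simp only [Finset.sum_apply, Pi.smul_apply, coordVec, smul_eq_mul, mul_ite, mul_one, mul_zero,
    Nat.cast_inj, ← Fin.ext_iff, ite_and]
  simp

/-- The formal derivative at `(t, X)` is the derivative of `f` in the direction
`(1, ẋ, …, x^{(m+1)})`. -/
theorem totalDeriv_eq_fderiv {n m : ℕ} (f : ℝ × Jet n m → ℝ) (w : ℝ × Jet n (m + 1)) :
    totalDeriv f w = fderiv ℝ f (truncL (Nat.le_succ m) w) (1, shiftL n m w.2) := by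
  have : ((1, shiftL n m w.2) : ℝ × Jet n m) = (1, 0) + ∑ k : Fin (m + 1), ∑ j : Fin n,
      w.2 k.succ j • ((0, coordVec m j ((k : ℕ) : ℤ)) : ℝ × Jet n m) := by
    refine Prod.ext ?_ ?_
    · simp [Prod.fst_sum]
    · rw [Prod.snd_add, Prod.snd_sum]
      simp only [Prod.snd_sum, Prod.smul_snd, zero_add]
      exact jet_eq_sum_coordVec _
  rw [this, map_add, map_sum]
  simp only [map_sum, map_smul, totalDeriv, pderivX_eq_fderiv, pderivT, smul_eq_mul, truncL_apply,
    mul_comm]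

theorem isOpen_prolong {n l : ℕ} {Ω : Set (Jet n l)} (hΩ : IsOpen Ω) (d : ℕ) :
    IsOpen (prolong Ω d) :=
  hΩ.preimage (by unfold trunc; fun_prop)

/-! ### Formal derivatives of analytic functions -/

theorem analyticOnNhd_totalDeriv {n m : ℕ} {f : ℝ × Jet n m → ℝ} {S : Set (ℝ × Jet n m)}
    (hf : AnalyticOnNhd ℝ f S) :
    AnalyticOnNhd ℝ (totalDeriv f) (truncL (Nat.le_succ m) ⁻¹' S) := by
  intro w hw
  have h1 : AnalyticAt ℝ (fun w => fderiv ℝ f (truncL (Nat.le_succ m) w)) w :=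
    AnalyticAt.fun_comp (hf.fderiv _ hw) ((truncL _).analyticAt w)
  have h2 : AnalyticAt ℝ (fun w : ℝ × Jet n (m + 1) => ((1, shiftL n m w.2) : ℝ × Jet n m)) w :=
    analyticAt_const.prod (((shiftL n m).comp (ContinuousLinearMap.snd ℝ ℝ _)).analyticAt w)
  rw [funext (totalDeriv_eq_fderiv f)]
  exact AnalyticAt.fun_comp (ContinuousLinearMap.analyticAt_bilinear
    (ContinuousLinearMap.id ℝ (ℝ × Jet n m →L[ℝ] ℝ)) _) (h1.prod h2)

/-- **Griewank's lemma**, one step: if `f` does not depend on `x_j^{(k')}` for `k' > k`, then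
`∂ḟ/∂x_j^{(k+1)} = ∂f/∂x_j^{(k)}`. -/
theorem pderivX_totalDeriv {n m : ℕ} {f : ℝ × Jet n m → ℝ} {S : Set (ℝ × Jet n m)}
    (hS : IsOpen S) (hf : AnalyticOnNhd ℝ f S) {j : Fin n} {k : ℤ}
    (h0 : ∀ z ∈ S, pderivX f j (k + 1) z = 0) {w : ℝ × Jet n (m + 1)}
    (hw : truncL (Nat.le_succ m) w ∈ S) :
    pderivX (totalDeriv f) j (k + 1) w = pderivX f j k (truncL (Nat.le_succ m) w) := by
  set z := truncL (Nat.le_succ m) w with hz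
  have h1 : HasFDerivAt (fun w => fderiv ℝ f (truncL (Nat.le_succ m) w))
      ((fderiv ℝ (fderiv ℝ f) z).comp (truncL (Nat.le_succ m))) w :=
    HasFDerivAt.comp w (hf.fderiv z hw).differentiableAt.hasFDerivAt (truncL _).hasFDerivAt
  have h2 : HasFDerivAt (fun w : ℝ × Jet n (m + 1) => ((1, shiftL n m w.2) : ℝ × Jet n m))
      ((0 : ℝ × Jet n (m + 1) →L[ℝ] ℝ).prod
        ((shiftL n m).comp (ContinuousLinearMap.snd ℝ ℝ (Jet n (m + 1))))) w :=
    (hasFDerivAt_const _ _).prodMk ((shiftL n m).comp (ContinuousLinearMap.snd ℝ ℝ _)).hasFDerivAt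
  have h3 := h1.clm_apply h2
  have h4 : totalDeriv f =
      fun w => fderiv ℝ f (truncL (Nat.le_succ m) w) (1, shiftL n m w.2) :=
    funext (totalDeriv_eq_fderiv f)
  rw [← h4] at h3
  rw [pderivX_eq_fderiv, pderivX_eq_fderiv, h3.fderiv]
  have hsymm : IsSymmSndFDerivAt ℝ f z :=
    (hf z hw).contDiffAt.isSymmSndFDerivAt_of_omega
  -- the second order term is the derivative of the vanishing function `∂f/∂x_j^{(k+1)}`
  have h5 : fderiv ℝ (fderiv ℝ f) z (1, shiftL n m w.2) (0, coordVec m j (k + 1)) = 0 := by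
    have h6 : HasFDerivAt (fun z => fderiv ℝ f z (0, coordVec m j (k + 1)))
        ((fderiv ℝ (fderiv ℝ f) z).flip (0, coordVec m j (k + 1))) z := by
      simpa using (hf.fderiv z hw).differentiableAt.hasFDerivAt.clm_apply
        (hasFDerivAt_const ((0, coordVec m j (k + 1)) : ℝ × Jet n m) z)
    have h7 : (fun z => fderiv ℝ f z (0, coordVec m j (k + 1))) =ᶠ[𝓝 z] fun _ => (0 : ℝ) := by
      filter_upwards [hS.mem_nhds hw] with y hy
      rw [← pderivX_eq_fderiv, h0 y hy]
    have h8 := h6.unique ((hasFDerivAt_const (0 : ℝ) z).congr_of_eventuallyEq h7)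
    have := congrArg (fun L => L (1, shiftL n m w.2)) h8
    simpa using this
  rw [hsymm.eq] at h5
  simp only [add_apply, ContinuousLinearMap.comp_apply,
    ContinuousLinearMap.flip_apply, ContinuousLinearMap.prod_apply, truncL_apply, trunc_coordVec,
    ContinuousLinearMap.coe_snd', shiftL_coordVec, zero_apply, h5]
  simp [hz]

theorem analyticOnNhd_iterTotalDeriv {n l : ℕ} {f : ℝ × Jet n l → ℝ} {S : Set (ℝ × Jet n l)}
    (hf : AnalyticOnNhd ℝ f S) (d : ℕ) :
    AnalyticOnNhd ℝ (iterTotalDeriv f d) (truncL (Nat.le_add_right l d) ⁻¹' S) := by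
  induction d with
  | zero => exact hf
  | succ d ih => exact analyticOnNhd_totalDeriv ih

/-- **Griewank's lemma**: if `f` does not depend on `x_j^{(k')}` for `k' > k`, then
`∂f^{(d)}/∂x_j^{(k'+d)} = ∂f/∂x_j^{(k')}` for all `k' ≥ k`. -/
theorem pderivX_iterTotalDeriv {n l : ℕ} {f : ℝ × Jet n l → ℝ} {S : Set (ℝ × Jet n l)}
    (hS : IsOpen S) (hf : AnalyticOnNhd ℝ f S) {j : Fin n} {k : ℤ}
    (h0 : ∀ k' > k, ∀ z ∈ S, pderivX f j k' z = 0) (d : ℕ) {k' : ℤ} (hk : k ≤ k')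
    {w : ℝ × Jet n (l + d)} (hw : truncL (Nat.le_add_right l d) w ∈ S) :
    pderivX (iterTotalDeriv f d) j (k' + d) w =
      pderivX f j k' (truncL (Nat.le_add_right l d) w) := by
  induction d generalizing k' with
  | zero => simp only [Nat.cast_zero, add_zero]; rfl
  | succ d ih =>
    have hS' : IsOpen (truncL (n := n) (Nat.le_add_right l d) ⁻¹' S) :=
      hS.preimage (truncL _).continuous
    have h1 := pderivX_totalDeriv hS' (analyticOnNhd_iterTotalDeriv hf d) (j := j) (k := k' + d)
      (fun z hz => by
        rw [add_right_comm, ih (by omega) hz]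
        exact h0 _ (by omega) _ hz) (w := w) hw
    have h2 : k' + ((d + 1 : ℕ) : ℤ) = k' + d + 1 := by push_cast; ring
    rw [h2]
    exact h1.trans (ih hk hw)

theorem pderivX_comp_truncL {n m M : ℕ} (h : m ≤ M) {f : ℝ × Jet n m → ℝ} {w : ℝ × Jet n M}
    (hf : DifferentiableAt ℝ f (truncL h w)) (j : Fin n) (k : ℤ) :
    pderivX (fun z => f (truncL h z)) j k w = pderivX f j k (truncL h w) := by
  have h1 : HasFDerivAt (fun z => f (truncL h z)) ((fderiv ℝ f (truncL h w)).comp (truncL h)) w :=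
    hf.hasFDerivAt.comp w (truncL h).hasFDerivAt
  rw [pderivX_eq_fderiv, pderivX_eq_fderiv, h1.fderiv]
  simp [trunc_coordVec]

theorem analyticOnNhd_iterTotalDerivLift {n l : ℕ} {f : ℝ × Jet n l → ℝ}
    {S : Set (ℝ × Jet n l)} (hf : AnalyticOnNhd ℝ f S) {d κ : ℕ} (h : d ≤ κ) :
    AnalyticOnNhd ℝ (iterTotalDerivLift f d κ h) (truncL (Nat.le_add_right l κ) ⁻¹' S) :=
  fun w hw => AnalyticAt.fun_comp (g := iterTotalDeriv f d) (f := truncL (Nat.add_le_add_left h l))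
    (analyticOnNhd_iterTotalDeriv hf d _ hw) ((truncL _).analyticAt w)

theorem pderivX_iterTotalDerivLift {n l : ℕ} {f : ℝ × Jet n l → ℝ} {S : Set (ℝ × Jet n l)}
    (hS : IsOpen S) (hf : AnalyticOnNhd ℝ f S) {j : Fin n} {k : ℤ}
    (h0 : ∀ k' > k, ∀ z ∈ S, pderivX f j k' z = 0) {d κ : ℕ} (h : d ≤ κ) {k' : ℤ}
    (hk : k ≤ k') {w : ℝ × Jet n (l + κ)} (hw : truncL (Nat.le_add_right l κ) w ∈ S) :
    pderivX (iterTotalDerivLift f d κ h) j (k' + d) w =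
      pderivX f j k' (truncL (Nat.le_add_right l κ) w) :=
  (pderivX_comp_truncL (Nat.add_le_add_left h l)
    (analyticOnNhd_iterTotalDeriv hf d _ hw).differentiableAt j _).trans
    (pderivX_iterTotalDeriv hS hf h0 d hk hw)

/-! ### Formal derivatives along trajectories -/

theorem hasDerivAt_jet {n m : ℕ} {x : ℝ → Fin n → ℝ} {t : ℝ}
    (hx : ContDiffAt ℝ ((m + 1 : ℕ) : WithTop ℕ∞) x t) :
    HasDerivAt (jet m x) (shiftL n m (jet (m + 1) x t)) t := by
  rw [hasDerivAt_pi]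
  intro k
  have h : DifferentiableAt ℝ (iteratedDeriv (k : ℕ) x) t := by
    rw [iteratedDeriv_eq_equiv_comp]
    exact (LinearIsometryEquiv.differentiable _).differentiableAt.comp t
      (hx.differentiableAt_iteratedFDeriv (by exact_mod_cast k.2))
  have h' := h.hasDerivAt
  rw [← iteratedDeriv_succ] at h'
  exact h'

/-- If `f` vanishes along a trajectory, then so does its formal derivative. -/
theorem totalDeriv_eq_zero_of_forall {n m : ℕ} {f : ℝ × Jet n m → ℝ} {x : ℝ → Fin n → ℝ}
    {U : Set ℝ} (hU : IsOpen U) (hf : ∀ t ∈ U, DifferentiableAt ℝ f (t, jet m x t))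
    (hx : ContDiffOn ℝ ((m + 1 : ℕ) : WithTop ℕ∞) x U) (h : ∀ t ∈ U, f (t, jet m x t) = 0) :
    ∀ t ∈ U, totalDeriv f (t, jet (m + 1) x t) = 0 := by
  intro t ht
  have h1 : HasDerivAt (fun t => (t, jet m x t)) (1, shiftL n m (jet (m + 1) x t)) t :=
    (hasDerivAt_id t).prodMk (hasDerivAt_jet (hx.contDiffAt (hU.mem_nhds ht)))
  have h2 := (hf t ht).hasFDerivAt.comp_hasDerivAt t h1
  have h3 : (f ∘ fun t => (t, jet m x t)) =ᶠ[𝓝 t] fun _ => (0 : ℝ) := by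
    filter_upwards [hU.mem_nhds ht] with s hs using h s hs
  rw [totalDeriv_eq_fderiv]
  exact h2.unique ((hasDerivAt_const t (0 : ℝ)).congr_of_eventuallyEq h3)

theorem iterTotalDeriv_eq_zero_of_forall {n l : ℕ} {f : ℝ × Jet n l → ℝ}
    {S : Set (ℝ × Jet n l)} (hf : AnalyticOnNhd ℝ f S) {x : ℝ → Fin n → ℝ} {U : Set ℝ}
    (hU : IsOpen U) (hS : ∀ t ∈ U, (t, jet l x t) ∈ S) (h : ∀ t ∈ U, f (t, jet l x t) = 0)
    (d : ℕ) (hx : ContDiffOn ℝ ((l + d : ℕ) : WithTop ℕ∞) x U) :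
    ∀ t ∈ U, iterTotalDeriv f d (t, jet (l + d) x t) = 0 := by
  induction d with
  | zero => exact h
  | succ d ih =>
    refine totalDeriv_eq_zero_of_forall hU (fun t ht => ?_) hx
      (ih (hx.of_le (by exact_mod_cast Nat.le_succ _)))
    exact (analyticOnNhd_iterTotalDeriv hf d _ (hS t ht)).differentiableAt

theorem iterTotalDerivLift_eq_zero_of_forall {n l : ℕ} {f : ℝ × Jet n l → ℝ}
    {S : Set (ℝ × Jet n l)} (hf : AnalyticOnNhd ℝ f S) {x : ℝ → Fin n → ℝ} {U : Set ℝ}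
    (hU : IsOpen U) (hS : ∀ t ∈ U, (t, jet l x t) ∈ S) (h : ∀ t ∈ U, f (t, jet l x t) = 0)
    {d κ : ℕ} (hd : d ≤ κ) (hx : ContDiffOn ℝ ((l + κ : ℕ) : WithTop ℕ∞) x U) :
    ∀ t ∈ U, iterTotalDerivLift f d κ hd (t, jet (l + κ) x t) = 0 :=
  iterTotalDeriv_eq_zero_of_forall hf hU hS h d
    (hx.of_le (by exact_mod_cast Nat.add_le_add_left hd l))

theorem continuousOn_jet {n m : ℕ} {x : ℝ → Fin n → ℝ} {U : Set ℝ} (hU : IsOpen U)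
    (hx : ContDiffOn ℝ (m : WithTop ℕ∞) x U) : ContinuousOn (jet m x) U := by
  rw [continuousOn_pi]
  intro k
  refine (hx.continuousOn_iteratedDerivWithin (m := (k : ℕ)) ?_ hU.uniqueDiffOn).congr ?_
  · exact_mod_cast Nat.lt_succ_iff.mp k.2
  · exact fun t ht => (iteratedDerivWithin_of_isOpen hU ht).symm

/-! ### Dual feasibility and the optimal value -/

section Assignment

variable {n m : ℕ} {S : Set (ℝ × Jet n m)} {F : ℝ × Jet n m → Fin n → ℝ}

theorem dependsOn_of_ord_eq {f : ℝ × Jet n m → ℝ} {j : Fin n} {c : ℕ}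
    (h : ord S f j = (c : WithBot ℕ)) : DependsOn S f j c ∧ c ≤ m := by
  classical
  unfold ord at h
  rcases Finset.eq_empty_or_nonempty
    (Finset.univ.filter (fun k : Fin (m + 1) => DependsOn S f j k)) with h0 | h0
  · rw [h0, Finset.sup_empty] at h
    exact absurd h (WithBot.bot_ne_coe)
  · obtain ⟨k, hk, hk'⟩ := Finset.exists_mem_eq_sup _ h0 (fun k => ((k : ℕ) : WithBot ℕ))
    rw [h] at hk'
    have hc : c = k := by exact_mod_cast hk'
    subst hc
    exact ⟨(Finset.mem_filter.mp hk).2, Nat.lt_succ_iff.mp k.2⟩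

theorem DependsOn.le {f : ℝ × Jet n m → ℝ} {j : Fin n} {k : ℕ} (h : DependsOn S f j k) :
    k ≤ m := by
  obtain ⟨z, -, hz⟩ := h
  by_contra hk
  exact hz (dif_neg (by omega))

theorem DependsOn.exists_ord_eq {f : ℝ × Jet n m → ℝ} {j : Fin n} {k : ℕ}
    (h : DependsOn S f j k) : ∃ c : ℕ, ord S f j = (c : WithBot ℕ) ∧ k ≤ c := by
  classical
  have h1 : (k : WithBot ℕ) ≤ ord S f j := by
    have hmem : (⟨k, Nat.lt_succ_iff.mpr h.le⟩ : Fin (m + 1)) ∈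
        Finset.univ.filter (fun k : Fin (m + 1) => DependsOn S f j k) := by simpa using h
    exact Finset.le_sup (f := fun k : Fin (m + 1) => ((k : ℕ) : WithBot ℕ)) hmem
  cases hc : ord S f j with
  | bot => rw [hc] at h1; exact absurd h1 (by simp)
  | coe c => rw [hc] at h1; exact ⟨c, rfl, WithBot.coe_le_coe.mp h1⟩

theorem dualFeasible_iff {p q : Fin n → ℤ} :
    DualFeasible S F p q ↔
      ∀ i j, ∀ k : ℕ, DependsOn S (fun z => F z i) j k → (k : ℤ) ≤ q j - p i := by
  constructor
  · intro h i j k hk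
    obtain ⟨c, hc, hkc⟩ := hk.exists_ord_eq
    have := h i j c hc
    omega
  · exact fun h i j c hc => h i j c (dependsOn_of_ord_eq hc).1

theorem DualFeasible.pderivX_eq_zero {p q : Fin n → ℤ} (h : DualFeasible S F p q) (i j : Fin n)
    {k : ℤ} (hk : q j - p i < k) {z : ℝ × Jet n m} (hz : z ∈ S) :
    pderivX (fun w => F w i) j k z = 0 := by
  by_contra h0
  have hk0 : 0 ≤ k := by
    by_contra hneg
    exact h0 (dif_neg (by omega))
  lift k to ℕ using hk0
  have := dualFeasible_iff.mp h i j k ⟨z, hz, h0⟩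
  omega

theorem HasPerfectMatching.exists_dependsOn (h : HasPerfectMatching S F) :
    ∃ σ : Equiv.Perm (Fin n), ∀ i, ∃ k, DependsOn S (fun z => F z i) (σ i) k := by
  obtain ⟨σ, hσ⟩ := h
  refine ⟨σ, fun i => ?_⟩
  cases hc : ord S (fun z => F z i) (σ i) with
  | bot => exact absurd hc (hσ i)
  | coe c => exact ⟨c, (dependsOn_of_ord_eq hc).1⟩

theorem optValue_eq {p q : Fin n → ℤ} (h : DualOptimal S F p q) :
    optValue S F = (dualValue p q : ℤ) := by
  have hex : ∃ pq : (Fin n → ℤ) × (Fin n → ℤ), DualOptimal S F pq.1 pq.2 := ⟨(p, q), h⟩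
  unfold optValue
  rw [dif_pos hex]
  have := hex.choose_spec
  exact congrArg _ (le_antisymm (this.2 _ _ h.1) (h.2 _ _ this.1))

theorem optValue_le {p q : Fin n → ℤ} (h : DualFeasible S F p q) :
    optValue S F ≤ (dualValue p q : ℤ) := by
  by_cases hex : ∃ pq : (Fin n → ℤ) × (Fin n → ℤ), DualOptimal S F pq.1 pq.2
  · obtain ⟨pq, hpq⟩ := hex
    rw [optValue_eq hpq]
    exact_mod_cast hpq.2 _ _ h
  · unfold optValue
    rw [dif_neg hex]
    exact bot_le

/-! ### Bounded dual optimal solutions -/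

/-- The dual objective is nonnegative on feasible solutions, by summing over the perfect matching,
and therefore attains its minimum. -/
theorem exists_dualOptimal (h : HasPerfectMatching S F) : ∃ p q, DualOptimal S F p q := by
  obtain ⟨σ, hσ⟩ := h.exists_dependsOn
  have hnonneg : ∀ p q : Fin n → ℤ, DualFeasible S F p q → 0 ≤ dualValue p q := by
    intro p q hpq
    unfold dualValue
    rw [← Equiv.sum_comp σ q, ← Finset.sum_sub_distrib]
    refine Finset.sum_nonneg fun i _ => ?_
    obtain ⟨k, hk⟩ := hσ i
    have := dualFeasible_iff.mp hpq i (σ i) k hk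
    omega
  have h0 : DualFeasible S F (fun _ => 0) (fun _ => m) := by
    rw [dualFeasible_iff]
    intro i j k hk
    have := hk.le
    omega
  obtain ⟨⟨p, q⟩, hpq, hmin⟩ := WellFounded.has_min
    (measure fun pq : (Fin n → ℤ) × (Fin n → ℤ) => (dualValue pq.1 pq.2).toNat).wf
    {pq | DualFeasible S F pq.1 pq.2} ⟨(fun _ => 0, fun _ => m), h0⟩
  refine ⟨p, q, hpq, fun p' q' h' => ?_⟩
  have h1 : ¬ (dualValue p' q').toNat < (dualValue p q).toNat := hmin (p', q') h'
  have h2 := hnonneg _ _ hpq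
  have h3 := hnonneg _ _ h'
  omega

/-- If no `p_i` lies in the gap `[θ - m, θ)`, then lowering by one all the `p_i` and `q_j` that
are at least `θ` keeps a solution optimal: the perfect matching shows that at least as many `q_j`
as `p_i` are lowered. -/
theorem DualOptimal.lower {p q : Fin n → ℤ} (h : HasPerfectMatching S F)
    (hpq : DualOptimal S F p q) {θ : ℤ} (hθ : ∀ i, θ ≤ p i ∨ p i < θ - m) :
    DualOptimal S F (fun i => p i - if θ ≤ p i then 1 else 0)
      (fun j => q j - if θ ≤ q j then 1 else 0) := by
  obtain ⟨σ, hσ⟩ := h.exists_dependsOn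
  have hf := dualFeasible_iff.mp hpq.1
  refine ⟨?_, fun p' q' h' => le_trans ?_ (hpq.2 p' q' h')⟩
  · rw [dualFeasible_iff]
    intro i j k hk
    have h1 := hf i j k hk
    have h2 := hk.le
    have h3 := hθ i
    split_ifs <;> omega
  · have h1 : (∑ i, if θ ≤ p i then (1 : ℤ) else 0) ≤ ∑ j, if θ ≤ q j then (1 : ℤ) else 0 := by
      rw [← Equiv.sum_comp σ fun j => if θ ≤ q j then (1 : ℤ) else 0]
      refine Finset.sum_le_sum fun i _ => ?_
      obtain ⟨k, hk⟩ := hσ i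
      have := hf i (σ i) k hk
      split_ifs <;> omega
    unfold dualValue
    rw [Finset.sum_sub_distrib, Finset.sum_sub_distrib]
    linarith

/-- If below each positive `θ` that some `p_i` reaches there is a `p_i` at distance at most `m`,
then all the `p_i` are at most `(n - 1) m`: for an entry `M` of `p`, each of the intervals
`[M - k m, ∞)`, `k = 0, 1, …`, contains at least one more of the `n` entries than the preceding
one, as long as the preceding one is positive. -/
theorem add_le_mul_of_no_gap {p : Fin n → ℤ}
    (h : ∀ θ : ℤ, 1 ≤ θ → (∃ i, θ ≤ p i) → ∃ i, θ - m ≤ p i ∧ p i < θ) (i₀ : Fin n) :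
    p i₀ + m ≤ n * m := by
  by_contra hcon
  push Not at hcon
  have key : ∀ k : ℕ, (k : ℤ) * m < p i₀ + m →
      k + 1 ≤ (Finset.univ.filter fun i => p i₀ - k * m ≤ p i).card := by
    intro k
    induction k with
    | zero =>
      intro _
      exact Finset.card_pos.mpr ⟨i₀, by simp⟩
    | succ k ih =>
      intro hk
      push_cast at hk
      have hk' : (k : ℤ) * m < p i₀ := by linarith
      have hm : (0 : ℤ) ≤ m := Int.natCast_nonneg m
      have ih' := ih (by linarith)
      obtain ⟨i₁, hi₁, hmin⟩ := Finset.exists_min_image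
        (Finset.univ.filter fun i => p i₀ - k * m ≤ p i) p
        (Finset.card_pos.mp (by omega))
      have hi₁' := (Finset.mem_filter.mp hi₁).2
      obtain ⟨i₂, hi₂, hi₂'⟩ := h (p i₁) (by linarith) ⟨i₁, le_rfl⟩
      have hnot : i₂ ∉ Finset.univ.filter fun i => p i₀ - k * m ≤ p i :=
        fun hmem => absurd (hmin i₂ hmem) (by omega)
      have hsub : insert i₂ (Finset.univ.filter fun i => p i₀ - k * m ≤ p i) ⊆
          Finset.univ.filter fun i => p i₀ - ((k + 1 : ℕ) : ℤ) * m ≤ p i := by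
        intro i hi
        rw [Finset.mem_filter]
        refine ⟨Finset.mem_univ _, ?_⟩
        push_cast
        rcases Finset.mem_insert.mp hi with rfl | hi
        · linarith
        · have := (Finset.mem_filter.mp hi).2
          linarith
      have hcard := Finset.card_le_card hsub
      rw [Finset.card_insert_of_notMem hnot] at hcard
      omega
  have h1 := key n hcon
  have h2 := Finset.card_le_univ (Finset.univ.filter fun i => p i₀ - n * m ≤ p i)
  rw [Fintype.card_fin] at h2
  omega

theorem exists_dualOptimal_bounded (h : HasPerfectMatching S F) :
    ∃ p q : Fin n → ℤ, DualOptimal S F p q ∧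
      ∀ i, 0 ≤ p i ∧ p i ≤ n * m ∧ 0 ≤ q i ∧ q i ≤ n * m := by
  obtain ⟨p₀, q₀, h₀⟩ := exists_dualOptimal h
  obtain ⟨c, hc⟩ : ∃ c : ℤ, ∀ i, 0 ≤ p₀ i + c :=
    ⟨∑ i, |p₀ i|, fun i => by
      have := Finset.single_le_sum (f := fun i => |p₀ i|) (fun i _ => abs_nonneg _)
        (Finset.mem_univ i)
      have := neg_abs_le (p₀ i)
      linarith⟩
  have h₁ : DualOptimal S F (fun i => p₀ i + c) (fun j => q₀ j + c) := by
    refine ⟨?_, fun p' q' h' => le_trans (le_of_eq ?_) (h₀.2 p' q' h')⟩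
    · rw [dualFeasible_iff]
      intro i j k hk
      have := dualFeasible_iff.mp h₀.1 i j k hk
      omega
    · simp only [dualValue, Finset.sum_add_distrib]
      ring
  -- a nonnegative optimal solution with the smallest sum of the `p_i` has no gaps
  obtain ⟨⟨p, q⟩, ⟨hopt, hp⟩, hmin⟩ := WellFounded.has_min
    (measure fun pq : (Fin n → ℤ) × (Fin n → ℤ) => (∑ i, pq.1 i).toNat).wf
    {pq | DualOptimal S F pq.1 pq.2 ∧ ∀ i, 0 ≤ pq.1 i} ⟨(_, _), h₁, hc⟩
  dsimp only at hopt hp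
  have hf := dualFeasible_iff.mp hopt.1
  have hgap : ∀ θ : ℤ, 1 ≤ θ → (∃ i, θ ≤ p i) → ∃ i, θ - m ≤ p i ∧ p i < θ := by
    rintro θ hθ ⟨i₁, hi₁⟩
    by_contra hcon
    push Not at hcon
    have hlow := hopt.lower h (θ := θ) fun i => by
      have := hcon i
      by_contra! hi
      omega
    have hnn : ∀ i, 0 ≤ p i - if θ ≤ p i then 1 else 0 := by
      intro i
      have := hp i
      split_ifs <;> omega
    refine hmin (_, _) ⟨hlow, hnn⟩ ?_
    change (∑ i, (p i - if θ ≤ p i then 1 else 0)).toNat < (∑ i, p i).toNat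
    have h1 : 0 ≤ ∑ i, (p i - if θ ≤ p i then 1 else 0) := Finset.sum_nonneg fun i _ => hnn i
    have h2 : ∑ i, (p i - if θ ≤ p i then 1 else 0) < ∑ i, p i :=
      Finset.sum_lt_sum (fun i _ => by split_ifs <;> omega)
        ⟨i₁, Finset.mem_univ _, by rw [if_pos hi₁]; omega⟩
    omega
  have hbound := add_le_mul_of_no_gap hgap
  have hm : (0 : ℤ) ≤ m := Int.natCast_nonneg m
  refine ⟨p, q, hopt, fun i => ⟨hp i, by linarith [hbound i], ?_, ?_⟩⟩
  · obtain ⟨σ, hσ⟩ := h.exists_dependsOn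
    obtain ⟨k, hk⟩ := hσ (σ.symm i)
    rw [σ.apply_symm_apply] at hk
    have := hf _ i k hk
    have := hp (σ.symm i)
    omega
  -- an entry `q_i > n m` could be lowered
  · by_contra hq
    have h1 : DualFeasible S F p (Function.update q i (q i - 1)) := by
      rw [dualFeasible_iff]
      intro i' j k hk
      by_cases hj : j = i
      · subst hj
        rw [Function.update_self]
        have := hk.le
        have := hbound i'
        omega
      · rw [Function.update_of_ne hj]
        exact hf i' j k hk
    have h2 := hopt.2 _ _ h1
    unfold dualValue at h2
    have h3 := Finset.sum_update_of_mem (Finset.mem_univ i) q (q i - 1)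
    have h4 := Finset.add_sum_erase Finset.univ q (Finset.mem_univ i)
    rw [Finset.erase_eq] at h4
    linarith

end Assignment

/-! ### Nonsingular matrices -/

section Matrix

variable {ι ι' κ κ' : Type} [Fintype ι] [Fintype ι'] [Fintype κ] [Fintype κ']
  [DecidableEq ι] [DecidableEq ι'] [DecidableEq κ] [DecidableEq κ']

theorem isNonsingular_submatrix_equiv (A : Matrix ι ι' ℝ) (e : κ ≃ ι) (f : κ' ≃ ι') :
    IsNonsingular (A.submatrix e f) ↔ IsNonsingular A := by
  have key : ∀ {ι ι' κ κ' : Type} [Fintype ι] [Fintype ι'] [Fintype κ] [Fintype κ']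
      [DecidableEq ι] [DecidableEq ι'] [DecidableEq κ] [DecidableEq κ'] (A : Matrix ι ι' ℝ)
      (e : κ ≃ ι) (f : κ' ≃ ι'), IsNonsingular A → IsNonsingular (A.submatrix e f) := by
    rintro ι ι' κ κ' _ _ _ _ _ _ _ _ A e f ⟨B, h1, h2⟩
    exact ⟨B.submatrix f e, by rw [Matrix.submatrix_mul_equiv, h1, Matrix.submatrix_one_equiv],
      by rw [Matrix.submatrix_mul_equiv, h2, Matrix.submatrix_one_equiv]⟩
  refine ⟨fun h => ?_, key A e f⟩
  have := key _ e.symm f.symm h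
  simpa using this

theorem isNonsingular_iff_det_ne_zero (A : Matrix ι ι ℝ) : IsNonsingular A ↔ A.det ≠ 0 := by
  rw [← isUnit_iff_ne_zero, ← Matrix.isUnit_iff_isUnit_det, isUnit_iff_exists]
  rfl

theorem IsNonsingular.card_eq {A : Matrix ι ι' ℝ} (h : IsNonsingular A) :
    Fintype.card ι = Fintype.card ι' := by
  obtain ⟨B, h1, h2⟩ := h
  exact Matrix.square_of_invertible A B h1 h2

theorem isNonsingular_iff_det_submatrix (A : Matrix ι ι' ℝ) (e : ι ≃ ι') :
    IsNonsingular A ↔ (A.submatrix id e).det ≠ 0 := by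
  rw [← isNonsingular_iff_det_ne_zero]
  exact (isNonsingular_submatrix_equiv A (Equiv.refl ι) e).symm

/-- If `D[I, J]` is nonsingular but no `D[I ∪ {r}, J']` is, then row `r` of `D` is a combination
of the rows in `I`: for a column `j ∉ J`, the difference of the two sides is the Schur complement
of `D[I, J]` in `D[I ∪ {r}, J ∪ {j}]`. -/
theorem exists_row_combination {n : ℕ} {D : Matrix (Fin n) (Fin n) ℝ} {I J : Finset (Fin n)}
    {r : Fin n} (hr : r ∉ I) (hIJ : IsNonsingular (sub D I J))
    (hmax : ∀ J', ¬ IsNonsingular (sub D (insert r I) J')) :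
    ∃ u : I → ℝ, ∀ j, D r j = ∑ i : I, u i * D i j := by
  let e : I ≃ J := Fintype.equivOfCardEq hIJ.card_eq
  set A : Matrix I I ℝ := (sub D I J).submatrix id e with hA
  have hdet : A.det ≠ 0 := (isNonsingular_iff_det_submatrix _ e).mp hIJ
  have hunit : IsUnit A.det := isUnit_iff_ne_zero.mpr hdet
  let c : Matrix Unit I ℝ := Matrix.of fun _ i => D r (e i)
  refine ⟨fun i => (c * A⁻¹) () i, fun j => ?_⟩
  by_cases hj : j ∈ J
  · have h1 : c * A⁻¹ * A = c := by
      rw [Matrix.mul_assoc, Matrix.nonsing_inv_mul _ hunit, Matrix.mul_one]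
    have h2 := congrFun (congrFun h1 ()) (e.symm ⟨j, hj⟩)
    rw [Matrix.mul_apply] at h2
    simpa [hA, c, sub] using h2.symm
  · by_contra hne
    refine hmax (insert j J) ?_
    let b : Matrix I Unit ℝ := Matrix.of fun i _ => D i j
    let δ : Matrix Unit Unit ℝ := Matrix.of fun _ _ => D r j
    let eI : I ⊕ Unit ≃ ↥(insert r I) :=
      (Equiv.optionEquivSumPUnit _).symm.trans (Finset.subtypeInsertEquivOption hr).symm
    let eJ : I ⊕ Unit ≃ ↥(insert j J) :=
      (e.sumCongr (Equiv.refl Unit)).trans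
        ((Equiv.optionEquivSumPUnit _).symm.trans (Finset.subtypeInsertEquivOption hj).symm)
    rw [← isNonsingular_submatrix_equiv _ eI eJ, isNonsingular_iff_det_ne_zero]
    have hblocks : (sub D (insert r I) (insert j J)).submatrix eI eJ =
        Matrix.fromBlocks A b c δ := by
      ext (a | a) (a' | a') <;> rfl
    let _ : Invertible A := Matrix.invertibleOfIsUnitDet A hunit
    rw [hblocks, Matrix.det_fromBlocks₁₁]
    refine mul_ne_zero hdet ?_
    rw [Matrix.det_unique, Matrix.invOf_eq_nonsing_inv, Matrix.sub_apply, sub_ne_zero,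
      Matrix.mul_apply]
    exact hne

end Matrix

/-! ### Admissible triples -/

section Admissible

variable {n l : ℕ} {T : Set ℝ} {Ω : Set (Jet n l)} {F : ℝ × Jet n l → Fin n → ℝ}
  {p q : Fin n → ℤ} {r : Fin n} {I J : Finset (Fin n)}

/-- A minimal set of rows in which all square submatrices of full size are identically singular,
together with a row `r` of it with the smallest `p_r`, gives an admissible triple. -/
theorem exists_isAdmissibleTriple (hne : (T ×ˢ Ω).Nonempty)
    (hsing : ∀ z ∈ T ×ˢ Ω, ¬ IsNonsingular (systemJacobian F p q z)) :
    ∃ r I J, IsAdmissibleTriple T Ω F p q r I J := by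
  obtain ⟨K, hK, hmin⟩ := WellFounded.has_min (wellFounded_lt (α := Finset (Fin n)))
    {I | ∀ J, ¬ NotIdenticallySingular (T ×ˢ Ω) (systemJacobian F p q) I J} ⟨Finset.univ, by
      rintro J ⟨z, hz, h⟩
      have hJ : J = Finset.univ := by
        rw [← Finset.card_eq_iff_eq_univ]
        simpa using h.card_eq.symm
      subst hJ
      refine hsing z hz ?_
      exact (isNonsingular_submatrix_equiv (systemJacobian F p q z)
        (Equiv.subtypeUnivEquiv Finset.mem_univ) (Equiv.subtypeUnivEquiv Finset.mem_univ)).mp h⟩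
  have hlt : ∀ I ⊂ K, ∃ J, NotIdenticallySingular (T ×ˢ Ω) (systemJacobian F p q) I J := by
    intro I hI
    by_contra hcon
    push Not at hcon
    exact hmin I hcon hI
  have hKne : K.Nonempty := by
    rw [Finset.nonempty_iff_ne_empty]
    rintro rfl
    obtain ⟨z, hz⟩ := hne
    refine hK ∅ ⟨z, hz, 0, ?_, ?_⟩ <;> exact Subsingleton.elim _ _
  obtain ⟨r, hr, hrmin⟩ := Finset.exists_min_image K p hKne
  obtain ⟨J, hJ⟩ := hlt (K.erase r) (Finset.erase_ssubset hr)
  refine ⟨r, K.erase r, J, Finset.notMem_erase r K, ?_, hJ, ⟨?_, ?_⟩,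
    fun i hi => hrmin i (Finset.mem_of_mem_erase hi)⟩
  · obtain ⟨z, -, h⟩ := hJ
    simpa only [Fintype.card_coe] using h.card_eq
  · exact ⟨_, J, Finset.subset_insert _ _, rfl, hJ⟩
  · rintro k ⟨I', J', hI', rfl, h⟩
    rw [Finset.insert_erase hr] at hI'
    have hssub : I' ⊂ K := hI'.ssubset_of_ne fun h' => hK J' (h' ▸ h)
    have := Finset.card_lt_card hssub
    rw [Finset.card_erase_of_mem hr]
    omega

theorem kappa_le {b : ℤ} (hb : ∀ i, 0 ≤ p i ∧ p i ≤ b) : (kappa p r I : ℤ) ≤ b := by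
  have h0 : 0 ≤ b := (hb r).1.trans (hb r).2
  have : kappa p r I ≤ b.toNat := Finset.sup_le fun i _ => by
    have := hb i
    have := hb r
    omega
  omega

theorem IsAdmissibleTriple.not_isNonsingular_insert (h : IsAdmissibleTriple T Ω F p q r I J)
    {z : ℝ × Jet n l} (hz : z ∈ T ×ˢ Ω) (J' : Finset (Fin n)) :
    ¬ IsNonsingular (sub (systemJacobian F p q z) (insert r I) J') := by
  intro hns
  have := h.rank_eq.2 ⟨insert r I, J', subset_rfl, rfl, z, hz, hns⟩
  rw [Finset.card_insert_of_notMem h.not_mem] at this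
  omega

/-- The variables `x_J^{(q - p_r)}` are among the coordinates `(x, …, x^{(l+κ)})`, since no column
of `D[I, J]` vanishes identically. -/
theorem IsAdmissibleTriple.order_bounds (h : IsAdmissibleTriple T Ω F p q r I J) {j : Fin n}
    (hj : j ∈ J) : 0 ≤ q j - p r ∧ q j - p r ≤ (l + kappa p r I : ℕ) := by
  obtain ⟨z, -, B, -, hB⟩ := h.nonsingular
  have h1 : ∃ i : I, systemJacobian F p q z i j ≠ 0 := by
    by_contra hcon
    push Not at hcon
    have h2 := congrFun (congrFun hB ⟨j, hj⟩) ⟨j, hj⟩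
    rw [Matrix.mul_apply, Finset.sum_eq_zero] at h2
    · simp at h2
    · intro i _
      simp [sub, hcon i]
  obtain ⟨i, hi⟩ := h1
  have h2 : 0 ≤ q j - p i ∧ q j - p i ≤ l := by
    by_contra hcon
    exact hi (dif_neg hcon)
  have h3 := h.le i i.2
  have h4 := le_kappa p r I i
  omega

end Admissible

section Substitution

variable {n l : ℕ} {T : Set ℝ} {Ω : Set (Jet n l)} {F : ℝ × Jet n l → Fin n → ℝ}
  {p q : Fin n → ℤ} {r : Fin n} {I J : Finset (Fin n)}

/-! ### Splitting the coordinates -/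

section Splitting

variable {M : ℕ}

/-- The entries `x_J^{(q - p_r)}` of `X`. An entry whose order `q_j - p_r` is out of range gets a
junk value. -/
def solvedPart (p q : Fin n → ℤ) (r : Fin n) (J : Finset (Fin n)) (X : Jet n M) : J → ℝ :=
  fun j => X (Fin.ofNat (M + 1) (q j - p r).toNat) j

theorem merge_rest_solvedPart (X : Jet n M) :
    merge p q r J (rest p q r J X) (solvedPart p q r J X) = X := by
  ext k j
  unfold merge
  split_ifs with h
  · have hk : Fin.ofNat (M + 1) (q j - p r).toNat = k := by
      have h2 : ((k : ℕ) : ℤ) = q j - p r := h.2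
      have h3 : (q j - p r).toNat = k := by omega
      rw [h3]
      simp
    change X (Fin.ofNat (M + 1) (q j - p r).toNat) j = X k j
    rw [hk]
  · rfl

theorem rest_merge (v : Rest p q r J M) (y : J → ℝ) :
    rest p q r J (merge p q r J v y) = v := by
  ext ⟨⟨k, j⟩, h⟩
  exact dif_neg h

theorem solvedPart_merge (hJ : ∀ j ∈ J, 0 ≤ q j - p r ∧ q j - p r ≤ (M : ℕ))
    (v : Rest p q r J M) (y : J → ℝ) : solvedPart p q r J (merge p q r J v y) = y := by
  ext ⟨j, hj⟩
  have h := hJ j hj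
  refine dif_pos (⟨hj, ?_⟩ : IsSolvedCoord p q r J _)
  have h2 : (q j - p r).toNat % (M + 1) = (q j - p r).toNat := Nat.mod_eq_of_lt (by omega)
  simp only [Fin.ofNat, h2]
  omega

/-- `merge` as a linear map. -/
noncomputable def mergeL (p q : Fin n → ℤ) (r : Fin n) (J : Finset (Fin n)) (M : ℕ) :
    Rest p q r J M × (J → ℝ) →L[ℝ] Jet n M :=
  ContinuousLinearMap.pi fun k => ContinuousLinearMap.pi fun j =>
    if h : IsSolvedCoord p q r J (k, j) then
      (ContinuousLinearMap.proj (R := ℝ) (φ := fun _ : J => ℝ) ⟨j, h.1⟩).comp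
        (ContinuousLinearMap.snd ℝ _ _)
    else
      (ContinuousLinearMap.proj (R := ℝ)
        (φ := fun _ : {kj : Fin (M + 1) × Fin n // ¬ IsSolvedCoord p q r J kj} => ℝ)
        ⟨(k, j), h⟩).comp (ContinuousLinearMap.fst ℝ _ _)

theorem mergeL_apply (v : Rest p q r J M) (y : J → ℝ) :
    mergeL p q r J M (v, y) = merge p q r J v y := by
  ext k j
  simp only [mergeL, merge, ContinuousLinearMap.pi_apply]
  split_ifs <;> rfl

/-- The map `(t, X) ↦ (t, v)` that drops the entries `x_J^{(q - p_r)}`. -/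
noncomputable def restL (p q : Fin n → ℤ) (r : Fin n) (J : Finset (Fin n)) (M : ℕ) :
    ℝ × Jet n M →L[ℝ] ℝ × Rest p q r J M :=
  (ContinuousLinearMap.fst ℝ ℝ (Jet n M)).prod
    ((ContinuousLinearMap.pi fun kj => (ContinuousLinearMap.proj (R := ℝ)
      (φ := fun _ : Fin n => ℝ) kj.1.2).comp
        (ContinuousLinearMap.proj (R := ℝ) (φ := fun _ : Fin (M + 1) => Fin n → ℝ) kj.1.1)).comp
      (ContinuousLinearMap.snd ℝ ℝ (Jet n M)))

theorem restL_apply (z : ℝ × Jet n M) : restL p q r J M z = (z.1, rest p q r J z.2) := rfl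

/-- The map `((t, v), y) ↦ (t, X)` inverse to the splitting of the coordinates. -/
noncomputable def joinL (p q : Fin n → ℤ) (r : Fin n) (J : Finset (Fin n)) (M : ℕ) :
    (ℝ × Rest p q r J M) × (J → ℝ) →L[ℝ] ℝ × Jet n M :=
  ((ContinuousLinearMap.fst ℝ ℝ (Rest p q r J M)).comp (ContinuousLinearMap.fst ℝ _ _)).prod
    ((mergeL p q r J M).comp
      (((ContinuousLinearMap.snd ℝ ℝ (Rest p q r J M)).comp (ContinuousLinearMap.fst ℝ _ _)).prod
        (ContinuousLinearMap.snd ℝ _ _)))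

theorem joinL_apply (u : (ℝ × Rest p q r J M) × (J → ℝ)) :
    joinL p q r J M u = (u.1.1, merge p q r J u.1.2 u.2) := by
  rw [← mergeL_apply]
  rfl

/-- The case of an order `q_j - p_r` out of range is included: such an entry of `a` contributes zero
to both sides. -/
theorem joinL_inr (a : J → ℝ) :
    joinL p q r J M (0, a) = ∑ j : J, a j • (0, coordVec M (j : Fin n) (q j - p r)) := by
  rw [joinL_apply]
  refine Prod.ext (by simp [Prod.fst_sum]) ?_
  rw [Prod.snd_sum]
  ext k j
  simp only [Finset.sum_apply, Prod.smul_snd, Pi.smul_apply, coordVec, smul_eq_mul, mul_ite,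
    mul_one, mul_zero, merge]
  split_ifs with h
  · rw [Finset.sum_eq_single ⟨j, h.1⟩]
    · exact (if_pos ⟨h.2, rfl⟩).symm
    · rintro j' - hj'
      exact if_neg fun h' => hj' (Subtype.ext h'.2.symm)
    · exact fun h' => absurd (Finset.mem_univ _) h'
  · refine (Finset.sum_eq_zero fun j' _ => if_neg fun h' => h ⟨?_, ?_⟩).symm
    · rw [h'.2]; exact j'.2
    · rw [h'.1, ← h'.2]

/-- Replacing the entries `x_J^{(q - p_r)}` by zero kills a coordinate direction or fixes it. -/
theorem exists_joinL_restL_coordVec (j : Fin n) (k : ℤ) :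
    ∃ c : ℝ, joinL p q r J M (restL p q r J M (0, coordVec M j k), 0) =
      c • (0, coordVec M j k) := by
  refine ⟨if j ∈ J ∧ k = q j - p r then 0 else 1, ?_⟩
  rw [joinL_apply, restL_apply]
  refine Prod.ext (mul_zero _).symm ?_
  ext a b
  simp only [merge, rest, coordVec, Prod.smul_snd, Pi.smul_apply, smul_eq_mul]
  by_cases hab : ((a : ℕ) : ℤ) = k ∧ b = j
  · obtain ⟨rfl, rfl⟩ := hab
    by_cases h : IsSolvedCoord p q r J (a, b)
    · have h' : b ∈ J ∧ ((a : ℕ) : ℤ) = q b - p r := h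
      simp [h, h']
    · have h' : ¬ (b ∈ J ∧ ((a : ℕ) : ℤ) = q b - p r) := h
      simp only [dif_neg h, if_neg h', one_mul]
  · simp only [if_neg hab, mul_zero]
    split_ifs <;> rfl

end Splitting

/-! ### The system of differentiated equations -/

theorem analyticOnNhd_component {m : ℕ} {S : Set (ℝ × Jet n m)} {F : ℝ × Jet n m → Fin n → ℝ}
    (hF : AnalyticOnNhd ℝ F S) (i : Fin n) : AnalyticOnNhd ℝ (fun z => F z i) S :=
  analyticOnNhd_pi_iff.mp hF i

theorem analyticOnNhd_diffI (hF : AnalyticOnNhd ℝ F (T ×ˢ Ω)) (i : I) :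
    AnalyticOnNhd ℝ (diffI F p r I i) (T ×ˢ prolong Ω (kappa p r I)) :=
  analyticOnNhd_iterTotalDerivLift (analyticOnNhd_component hF i) _

theorem truncL_mem {d : ℕ} {w : ℝ × Jet n (l + d)} (hw : w ∈ T ×ˢ prolong Ω d) :
    truncL (Nat.le_add_right l d) w ∈ T ×ˢ Ω := hw

/-- In the orders that matter, the partial derivatives of the differentiated equations are the
entries of the system Jacobian. -/
theorem pderivX_diffI (hopen : IsOpen (T ×ˢ Ω)) (hF : AnalyticOnNhd ℝ F (T ×ˢ Ω))
    (hpq : DualFeasible (T ×ˢ Ω) F p q) (hle : ∀ i ∈ I, p r ≤ p i) (i : I) {j : Fin n} {k : ℤ}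
    (hk : q j - p r ≤ k) {w : ℝ × Jet n (l + kappa p r I)}
    (hw : w ∈ T ×ˢ prolong Ω (kappa p r I)) :
    pderivX (diffI F p r I i) j k w =
      pderivX (fun z => F z i) j (k - (p i - p r)) (truncL (Nat.le_add_right l _) w) := by
  have h1 := hle i i.2
  have h2 := pderivX_iterTotalDerivLift hopen (analyticOnNhd_component hF i)
    (j := j) (k := q j - p i) (fun k' hk' z hz => hpq.pderivX_eq_zero i j hk' hz)
    (le_kappa p r I i) (k' := k - (p i - p r)) (by omega) (truncL_mem hw)
  rw [← h2]
  have h3 : k = k - (p i - p r) + ((p i - p r).toNat : ℤ) := by omega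
  conv_lhs => rw [h3]
  rfl

theorem jacobianIJ_eq (hopen : IsOpen (T ×ˢ Ω)) (hF : AnalyticOnNhd ℝ F (T ×ˢ Ω))
    (hpq : DualFeasible (T ×ˢ Ω) F p q) (hle : ∀ i ∈ I, p r ≤ p i)
    {w : ℝ × Jet n (l + kappa p r I)} (hw : w ∈ T ×ˢ prolong Ω (kappa p r I)) :
    jacobianIJ F p q r I J w =
      sub (systemJacobian F p q (truncL (Nat.le_add_right l _) w)) I J := by
  ext i j
  have := pderivX_diffI hopen hF hpq hle i (j := (j : Fin n)) le_rfl hw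
  simp only [jacobianIJ, sub, systemJacobian, Matrix.of_apply, Matrix.submatrix_apply]
  rw [this]
  congr 1
  ring

theorem diffI_eq_zero_of_solves (hF : AnalyticOnNhd ℝ F (T ×ˢ Ω)) {x : ℝ → Fin n → ℝ}
    {U : Set ℝ} (hU : IsOpen U) (hx : ContDiffOn ℝ ((l + kappa p r I : ℕ) : WithTop ℕ∞) x U)
    (hmem : ∀ t ∈ U, (t, jet l x t) ∈ T ×ˢ Ω) (h : ∀ i ∈ I, ∀ t ∈ U, F (t, jet l x t) i = 0)
    (i : I) : ∀ t ∈ U, diffI F p r I i (t, jet (l + kappa p r I) x t) = 0 :=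
  iterTotalDerivLift_eq_zero_of_forall (analyticOnNhd_component hF i) hU hmem
    (h i i.2) _ hx

/-- A consistent point at which `D[I, J]` is nonsingular, prolonged along the smooth solution
through it, is a base point. -/
theorem exists_isBasePoint (hopen : IsOpen (T ×ˢ Ω)) (hF : AnalyticOnNhd ℝ F (T ×ˢ Ω))
    (hpq : DualFeasible (T ×ˢ Ω) F p q) (hcons : ConsistencyAssumption (T ×ˢ Ω) F p q)
    (hadm : IsAdmissibleTriple T Ω F p q r I J) : ∃ z, IsBasePoint T Ω F p q r I J z := by
  obtain ⟨⟨t, X⟩, ⟨U, x, hU, ht, hx, hsol, hX⟩, hns⟩ := hcons I J hadm.nonsingular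
  dsimp only at ht hX
  subst hX
  have hmem : ((t, jet (l + kappa p r I) x t) : ℝ × Jet n (l + kappa p r I)) ∈
      T ×ˢ prolong Ω (kappa p r I) := (hsol t ht).1
  refine ⟨(t, jet (l + kappa p r I) x t), hmem, fun i => ?_, ?_⟩
  · exact diffI_eq_zero_of_solves hF hU.1 (hx.of_le (by exact_mod_cast le_top))
      (fun s hs => (hsol s hs).1) (fun i _ s hs => congrFun (hsol s hs).2 i) i t ht
  · rw [jacobianIJ_eq hopen hF hpq hadm.le hmem]
    exact hns

/-! ### The explicit function -/

theorem continuousAt_jacobianIJ (hF : AnalyticOnNhd ℝ F (T ×ˢ Ω))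
    {w : ℝ × Jet n (l + kappa p r I)} (hw : w ∈ T ×ˢ prolong Ω (kappa p r I)) :
    ContinuousAt (jacobianIJ F p q r I J) w := by
  refine continuousAt_pi.mpr fun i => continuousAt_pi.mpr fun j => ?_
  have h1 : (fun z => jacobianIJ F p q r I J z i j) =
      fun z => fderiv ℝ (diffI F p r I i) z (0, coordVec _ (j : Fin n) (q j - p r)) :=
    funext fun z => pderivX_eq_fderiv _ _ _ _
  rw [h1]
  exact ((analyticOnNhd_diffI hF i).fderiv w hw).continuousAt.clm_apply continuousAt_const

/-- The derivative of `F_I^{(p - p_r)}` with respect to the solved coordinates is given by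
`jacobianIJ`. -/
theorem fderiv_diffI_joinL_inr {i : I} {w : ℝ × Jet n (l + kappa p r I)} (a : J → ℝ) :
    fderiv ℝ (diffI F p r I i) w (joinL p q r J _ (0, a)) =
      (jacobianIJ F p q r I J w).mulVec a i := by
  rw [joinL_inr, map_sum]
  simp only [map_smul, ← pderivX_eq_fderiv, smul_eq_mul, Matrix.mulVec, dotProduct, jacobianIJ,
    Matrix.of_apply, mul_comm]

/-- The analytic implicit function theorem, applied to the differentiated equations in the split
coordinates; the neighbourhoods it provides are shrunk to a box `T' × V × W`. -/
theorem exists_isExplicitFunction (hT : IsOpen T) (hΩ : IsOpen Ω)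
    (hF : AnalyticOnNhd ℝ F (T ×ˢ Ω)) {z : ℝ × Jet n (l + kappa p r I)}
    (hz : IsBasePoint T Ω F p q r I J z) :
    ∃ T' V W φ, IsExplicitFunction T Ω F p q r I J T' V W φ z := by
  obtain ⟨hmem, hzero, hns⟩ := hz
  let M := l + kappa p r I
  let E := joinL p q r J M
  let f : (ℝ × Rest p q r J M) × (J → ℝ) → I → ℝ := fun u i => diffI F p r I i (E u)
  let u₀ : (ℝ × Rest p q r J M) × (J → ℝ) := (restL p q r J M z, solvedPart p q r J z.2)
  have hE : E u₀ = z := by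
    rw [joinL_apply]
    exact Prod.ext rfl (merge_rest_solvedPart z.2)
  have hana : AnalyticAt ℝ f u₀ := by
    refine analyticAt_pi_iff.mpr fun i => ?_
    exact AnalyticAt.fun_comp (analyticOnNhd_diffI hF i _ (hE.symm ▸ hmem)) (E.analyticAt u₀)
  have hcd : ContDiffAt ℝ ω f u₀ := hana.contDiffAt
  have hderiv : ∀ a, (fderiv ℝ f u₀ ∘L .inr ℝ _ _) a = (jacobianIJ F p q r I J z).mulVec a := by
    intro a
    have h1 : HasFDerivAt f (ContinuousLinearMap.pi fun i =>
        (fderiv ℝ (diffI F p r I i) z).comp E) u₀ := by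
      refine hasFDerivAt_pi.mpr fun i => ?_
      have h2 : HasFDerivAt (diffI F p r I i) (fderiv ℝ (diffI F p r I i) z) (E u₀) := by
        rw [hE]
        exact (analyticOnNhd_diffI hF i _ hmem).differentiableAt.hasFDerivAt
      exact h2.comp u₀ E.hasFDerivAt
    rw [h1.fderiv]
    ext i
    exact fderiv_diffI_joinL_inr a
  have hinv : (fderiv ℝ f u₀ ∘L .inr ℝ _ _).IsInvertible := by
    obtain ⟨B, hB1, hB2⟩ := hns
    refine ContinuousLinearMap.IsInvertible.of_inverse
      (g := LinearMap.toContinuousLinearMap B.mulVecLin) ?_ ?_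
    · refine ContinuousLinearMap.ext fun a => ?_
      rw [ContinuousLinearMap.comp_apply, hderiv]
      simp [Matrix.mulVec_mulVec, hB1]
    · refine ContinuousLinearMap.ext fun a => ?_
      rw [ContinuousLinearMap.comp_apply, hderiv]
      simp [Matrix.mulVec_mulVec, hB2]
  have hω : (ω : WithTop ℕ∞) ≠ 0 := by simp
  let ψ := hcd.implicitFunction hω hinv
  have hψ₀ : ψ u₀.1 = u₀.2 := hcd.implicitFunction_apply_self hω hinv
  have hψ : AnalyticAt ℝ ψ u₀.1 := (hcd.contDiffAt_implicitFunction hω hinv).analyticAt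
  have hf₀ : f u₀ = 0 := funext fun i => by
    change diffI F p r I i (E u₀) = 0
    rw [hE]
    exact hzero i
  have hdom : T ×ˢ prolong Ω (kappa p r I) ∈ 𝓝 (E u₀) :=
    hE.symm ▸ (hT.prod (isOpen_prolong hΩ _)).mem_nhds hmem
  have hev1 : ∀ᶠ u in 𝓝 u₀, f u = f u₀ ↔ ψ u.1 = u.2 :=
    hcd.eventually_apply_eq_iff_implicitFunction hω hinv
  have hev2 : ∀ᶠ u in 𝓝 u₀, E u ∈ T ×ˢ prolong Ω (kappa p r I) :=
    E.continuous.continuousAt.eventually hdom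
  have hev3 : ∀ᶠ u in 𝓝 u₀, IsNonsingular (jacobianIJ F p q r I J (E u)) := by
    let e : I ≃ J := Fintype.equivOfCardEq hns.card_eq
    simp only [fun A => isNonsingular_iff_det_submatrix (A : Matrix I J ℝ) e] at hns ⊢
    have h1 : ContinuousAt (jacobianIJ F p q r I J) (E u₀) :=
      continuousAt_jacobianIJ hF (hE.symm ▸ hmem)
    have h2 : Continuous fun A : Matrix I J ℝ => (A.submatrix id e).det :=
      (continuous_id.matrix_submatrix id e).matrix_det
    have h3 : ContinuousAt (fun u => ((jacobianIJ F p q r I J (E u)).submatrix id e).det) u₀ :=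
      h2.continuousAt.comp
        (ContinuousAt.comp (g := jacobianIJ F p q r I J) h1 E.continuous.continuousAt)
    exact h3.eventually_ne (by rw [hE]; exact hns)
  obtain ⟨A, W, hA, hA₀, hW, hW₀, hAW⟩ := mem_nhds_prod_iff'.mp (hev1.and (hev2.and hev3))
  have hev4 : ∀ᶠ a in 𝓝 u₀.1, a ∈ A ∧ ψ a ∈ W ∧ AnalyticAt ℝ ψ a :=
    Filter.Eventually.and (hA.mem_nhds hA₀)
      ((hψ.continuousAt.eventually (hψ₀.symm ▸ hW.mem_nhds hW₀)).and
      hψ.eventually_analyticAt)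
  obtain ⟨T₁, V, hT₁, ht₁, hV, hV₀, hTV⟩ := mem_nhds_prod_iff'.mp hev4
  obtain ⟨ε, hε, hball⟩ := Metric.isOpen_iff.mp hT₁ _ ht₁
  have hbox : ∀ t ∈ Metric.ball u₀.1.1 ε, ∀ v ∈ V, (t, v) ∈ A ∧ ψ (t, v) ∈ W ∧
      AnalyticAt ℝ ψ (t, v) := fun t ht v hv => hTV (mk_mem_prod (hball ht) hv)
  have hAW' : ∀ t ∈ Metric.ball u₀.1.1 ε, ∀ v ∈ V, ∀ y ∈ W,
      (f ((t, v), y) = f u₀ ↔ ψ (t, v) = y) ∧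
      E ((t, v), y) ∈ T ×ˢ prolong Ω (kappa p r I) ∧
      IsNonsingular (jacobianIJ F p q r I J (E ((t, v), y))) :=
    fun t ht v hv y hy => hAW (mk_mem_prod (hbox t ht v hv).1 hy)
  have hcenter : u₀.1.1 ∈ Metric.ball u₀.1.1 ε := Metric.mem_ball_self hε
  refine ⟨Metric.ball u₀.1.1 ε, V, W, ψ, ⟨Metric.isOpen_ball, ?_⟩, hV, hW, ?_, ?_, hcenter, hV₀,
    ?_, ?_, ?_, ?_, ?_, ?_⟩
  · rw [Real.ball_eq_Ioo]
    exact ordConnected_Ioo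
  · exact fun t ht => (hAW' t ht _ hV₀ _ hW₀).2.1.1
  · rintro X ⟨v, hv, y, hy, rfl⟩
    have := (hAW' _ hcenter v hv y hy).2.1.2
    rwa [joinL_apply] at this
  · exact (hbox _ hcenter _ hV₀).2.1
  · change merge p q r J (rest p q r J z.2) (ψ u₀.1) = z.2
    rw [hψ₀]
    exact merge_rest_solvedPart z.2
  · rintro ⟨t, v⟩ ⟨ht, hv⟩
    exact (hbox t ht v hv).2.2
  · rintro ⟨t, v⟩ ⟨ht, hv⟩
    exact (hbox t ht v hv).2.1
  · intro t ht v hv y hy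
    rw [eq_comm (a := y), ← (hAW' t ht v hv y hy).1, hf₀, funext_iff]
    simp only [f, E, joinL_apply]
    rfl
  · intro t ht v hv
    have := (hAW' t ht v hv _ (hbox t ht v hv).2.1).2.2
    rwa [joinL_apply] at this

/-! ### The output system -/

variable {T' : Set ℝ} {V : Set (Rest p q r J (l + kappa p r I))} {W : Set (J → ℝ)}
  {φ : ℝ × Rest p q r J (l + kappa p r I) → J → ℝ} {z₀ : ℝ × Jet n (l + kappa p r I)}

/-- The point `(t, X)` with the coordinates `x_J^{(q - p_r)}` replaced by the values of `φ`. -/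
noncomputable def substPoint (φ : ℝ × Rest p q r J (l + kappa p r I) → J → ℝ)
    (z : ℝ × Jet n (l + kappa p r I)) : ℝ × Jet n (l + kappa p r I) :=
  joinL p q r J _ (restL p q r J _ z, φ (restL p q r J _ z))

theorem substPoint_eq (z : ℝ × Jet n (l + kappa p r I)) :
    substPoint φ z = (z.1, merge p q r J (rest p q r J z.2) (φ (z.1, rest p q r J z.2))) := by
  rw [substPoint, joinL_apply]
  rfl

theorem output_self :
    (fun z => output F p q r I J φ z r) =
      fun z => F (truncL (Nat.le_add_right l _) (substPoint φ z)) r := by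
  ext z
  rw [substPoint_eq]
  exact if_pos rfl

theorem output_of_ne {i : Fin n} (hi : i ≠ r) :
    (fun z => output F p q r I J φ z i) = fun z => F (truncL (Nat.le_add_right l _) z) i := by
  ext z
  exact if_neg hi

theorem mem_outDomain_iff (hadm : IsAdmissibleTriple T Ω F p q r I J)
    {X : Jet n (l + kappa p r I)} :
    X ∈ outDomain p q r I J V W ↔ rest p q r J X ∈ V ∧ solvedPart p q r J X ∈ W := by
  constructor
  · rintro ⟨v, hv, y, hy, rfl⟩
    rw [rest_merge, solvedPart_merge fun j hj => hadm.order_bounds hj]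
    exact ⟨hv, hy⟩
  · rintro ⟨hv, hy⟩
    exact ⟨_, hv, _, hy, (merge_rest_solvedPart X).symm⟩

theorem isOpen_outDomain (hadm : IsAdmissibleTriple T Ω F p q r I J) (hV : IsOpen V)
    (hW : IsOpen W) : IsOpen (outDomain p q r I J V W) := by
  have h : outDomain p q r I J V W =
      rest p q r J ⁻¹' V ∩ solvedPart p q r J ⁻¹' W := by
    ext X
    exact mem_outDomain_iff hadm
  rw [h]
  exact (hV.preimage (by unfold rest; fun_prop)).inter
    (hW.preimage (by unfold solvedPart; fun_prop))

theorem rest_mem_of_mem_outDomain {X : Jet n (l + kappa p r I)}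
    (hX : X ∈ outDomain p q r I J V W) : rest p q r J X ∈ V := by
  obtain ⟨v, hv, y, -, rfl⟩ := hX
  rwa [rest_merge]

namespace IsExplicitFunction

theorem substPoint_mem_outDomain (hφ : IsExplicitFunction T Ω F p q r I J T' V W φ z₀)
    {z : ℝ × Jet n (l + kappa p r I)} (hz : z ∈ T' ×ˢ outDomain p q r I J V W) :
    substPoint φ z ∈ T' ×ˢ outDomain p q r I J V W := by
  have hv := rest_mem_of_mem_outDomain hz.2
  rw [substPoint_eq]
  exact ⟨hz.1, _, hv, _, hφ.mapsTo (mk_mem_prod hz.1 hv), rfl⟩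

theorem substPoint_mem (hφ : IsExplicitFunction T Ω F p q r I J T' V W φ z₀)
    {z : ℝ × Jet n (l + kappa p r I)} (hz : z ∈ T' ×ˢ outDomain p q r I J V W) :
    substPoint φ z ∈ T ×ˢ prolong Ω (kappa p r I) :=
  prod_mono hφ.subset_T hφ.subset_Ω (hφ.substPoint_mem_outDomain hz)

theorem diffI_substPoint (hφ : IsExplicitFunction T Ω F p q r I J T' V W φ z₀)
    {z : ℝ × Jet n (l + kappa p r I)} (hz : z ∈ T' ×ˢ outDomain p q r I J V W) (i : I) :
    diffI F p r I i (substPoint φ z) = 0 := by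
  have hv := rest_mem_of_mem_outDomain hz.2
  rw [substPoint_eq]
  exact (hφ.zero_iff _ hz.1 _ hv _ (hφ.mapsTo (mk_mem_prod hz.1 hv))).mpr rfl i

/-- On the zero set of `F_I^{(p - p_r)}`, the substitution changes nothing. -/
theorem substPoint_eq_self (hφ : IsExplicitFunction T Ω F p q r I J T' V W φ z₀)
    (hadm : IsAdmissibleTriple T Ω F p q r I J)
    {z : ℝ × Jet n (l + kappa p r I)} (hz : z ∈ T' ×ˢ outDomain p q r I J V W)
    (h : ∀ i : I, diffI F p r I i z = 0) : substPoint φ z = z := by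
  obtain ⟨hv, hy⟩ := (mem_outDomain_iff hadm).mp hz.2
  have h1 := (hφ.zero_iff _ hz.1 _ hv _ hy).mp (by rwa [merge_rest_solvedPart])
  rw [substPoint_eq, ← h1, merge_rest_solvedPart]

theorem analyticAt_substPoint (hφ : IsExplicitFunction T Ω F p q r I J T' V W φ z₀)
    {z : ℝ × Jet n (l + kappa p r I)} (hz : z ∈ T' ×ˢ outDomain p q r I J V W) :
    AnalyticAt ℝ (substPoint φ) z := by
  have h1 : AnalyticAt ℝ φ (restL p q r J _ z) :=
    hφ.analytic _ (mk_mem_prod hz.1 (rest_mem_of_mem_outDomain hz.2))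
  have h2 := (restL p q r J (l + kappa p r I)).analyticAt z
  have h3 : AnalyticAt ℝ (fun w => (restL p q r J _ w, φ (restL p q r J _ w))) z :=
    h2.prod (AnalyticAt.fun_comp h1 h2)
  exact AnalyticAt.fun_comp (g := joinL p q r J (l + kappa p r I))
    (ContinuousLinearMap.analyticAt _ _) h3

theorem analyticOnNhd_output (hφ : IsExplicitFunction T Ω F p q r I J T' V W φ z₀)
    (hF : AnalyticOnNhd ℝ F (T ×ˢ Ω)) :
    AnalyticOnNhd ℝ (output F p q r I J φ) (T' ×ˢ outDomain p q r I J V W) := by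
  intro z hz
  refine analyticAt_pi_iff.mpr fun i => ?_
  by_cases hi : i = r
  · subst hi
    rw [output_self]
    exact AnalyticAt.fun_comp (g := fun w => F w i)
      (analyticOnNhd_component hF i _ (truncL_mem (hφ.substPoint_mem hz)))
      (AnalyticAt.fun_comp ((truncL _).analyticAt _) (hφ.analyticAt_substPoint hz))
  · rw [output_of_ne hi]
    exact AnalyticAt.fun_comp (g := fun w => F w i)
      (analyticOnNhd_component hF i _ (truncL_mem (prod_mono hφ.subset_T hφ.subset_Ω hz)))
      ((truncL _).analyticAt _)

/-! ### Local equivalence -/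

/-- On the zero set of `F_I^{(p - p_r)}`, the output system coincides with the input system. -/
theorem output_eq (hφ : IsExplicitFunction T Ω F p q r I J T' V W φ z₀)
    (hadm : IsAdmissibleTriple T Ω F p q r I J)
    {z : ℝ × Jet n (l + kappa p r I)} (hz : z ∈ T' ×ˢ outDomain p q r I J V W)
    (h : ∀ i : I, diffI F p r I i z = 0) :
    output F p q r I J φ z = F (truncL (Nat.le_add_right l _) z) := by
  ext i
  by_cases hi : i = r
  · subst hi
    have := congrFun (output_self (F := F) (p := p) (q := q) (φ := φ)) z
    rwa [hφ.substPoint_eq_self hadm hz h] at this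
  · exact congrFun (output_of_ne (F := F) (p := p) (q := q) (φ := φ) hi) z

/-- Each of the two systems contains the equations `F_I = 0`, hence forces `F_I^{(p - p_r)} = 0`
along the trajectory, where the two systems coincide. -/
theorem locallyEquivalent_output (hφ : IsExplicitFunction T Ω F p q r I J T' V W φ z₀)
    (hadm : IsAdmissibleTriple T Ω F p q r I J) (hF : AnalyticOnNhd ℝ F (T ×ˢ Ω)) :
    LocallyEquivalent T Ω F T' (outDomain p q r I J V W) (output F p q r I J φ) := by
  intro t₀ ht₀ X₀ hX₀ x hx hjet
  subst hjet
  have hcont := continuousOn_jet hφ.interval.1 hx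
  have hopen : IsOpen (T' ∩ jet (l + kappa p r I) x ⁻¹' outDomain p q r I J V W) :=
    hcont.isOpen_inter_preimage hφ.interval.1 (isOpen_outDomain hadm hφ.isOpen_V hφ.isOpen_W)
  obtain ⟨ε, hε, hball⟩ := Metric.isOpen_iff.mp hopen t₀ ⟨ht₀, hX₀⟩
  refine ⟨Metric.ball t₀ ε, ⟨Metric.isOpen_ball, by rw [Real.ball_eq_Ioo]; exact ordConnected_Ioo⟩,
    Metric.mem_ball_self hε, fun t ht => (hball ht).1, fun U hU _ hUε => ?_⟩
  have hmem : ∀ t ∈ U, (t, jet (l + kappa p r I) x t) ∈ T' ×ˢ outDomain p q r I J V W :=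
    fun t ht => hball (hUε ht)
  have hmem' : ∀ t ∈ U, (t, jet l x t) ∈ T ×ˢ Ω :=
    fun t ht => truncL_mem (prod_mono hφ.subset_T hφ.subset_Ω (hmem t ht))
  have hxU : ContDiffOn ℝ ((l + kappa p r I : ℕ) : WithTop ℕ∞) x U :=
    hx.mono fun t ht => (hmem t ht).1
  constructor
  · intro h t ht
    refine ⟨hmem t ht, ?_⟩
    rw [hφ.output_eq hadm (hmem t ht) fun i => diffI_eq_zero_of_solves hF hU.1 hxU hmem'
      (fun i _ s hs => congrFun (h s hs).2 i) i t ht]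
    exact (h t ht).2
  · intro h t ht
    refine ⟨hmem' t ht, ?_⟩
    rw [← (h t ht).2]
    refine (hφ.output_eq hadm (hmem t ht) fun i => diffI_eq_zero_of_solves hF hU.1 hxU hmem'
      (fun i hi s hs => ?_) i t ht).symm
    have hir : i ≠ r := fun h' => hadm.not_mem (h' ▸ hi)
    have h1 := congrFun (output_of_ne (F := F) (p := p) (q := q) (φ := φ) hir)
      (s, jet (l + kappa p r I) x s)
    exact h1.symm.trans (congrFun (h s hs).2 i)

/-! ### Decrease of the optimal value -/

/-- The derivative of the substitution in the direction of `x_j^{(k)}` is a combination of this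
direction and the directions of the entries of `x_J^{(q - p_r)}`. -/
theorem exists_pderivX_comp_substPoint (hφ : IsExplicitFunction T Ω F p q r I J T' V W φ z₀)
    {z : ℝ × Jet n (l + kappa p r I)} (hz : z ∈ T' ×ˢ outDomain p q r I J V W) (j : Fin n)
    (k : ℤ) :
    ∃ (c : ℝ) (a : J → ℝ), ∀ g : ℝ × Jet n (l + kappa p r I) → ℝ,
      DifferentiableAt ℝ g (substPoint φ z) →
      pderivX (fun w => g (substPoint φ w)) j k z = c * pderivX g j k (substPoint φ z) +
        ∑ j' : J, a j' * pderivX g j' (q j' - p r) (substPoint φ z) := by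
  obtain ⟨c, hc⟩ := exists_joinL_restL_coordVec (p := p) (q := q) (r := r) (J := J)
    (M := l + kappa p r I) j k
  have h1 : DifferentiableAt ℝ φ (restL p q r J _ z) :=
    (hφ.analytic _ (mk_mem_prod hz.1 (rest_mem_of_mem_outDomain hz.2))).differentiableAt
  have hR := (restL p q r J (l + kappa p r I)).hasFDerivAt (x := z)
  have h2 : HasFDerivAt (substPoint φ) _ z :=
    (joinL p q r J (l + kappa p r I)).hasFDerivAt.comp z
      (hR.prodMk (h1.hasFDerivAt.comp z hR))
  let a : J → ℝ := fderiv ℝ φ (restL p q r J _ z) (restL p q r J _ (0, coordVec _ j k))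
  refine ⟨c, a, fun g hg => ?_⟩
  have h3 : HasFDerivAt (fun w => g (substPoint φ w)) _ z := hg.hasFDerivAt.comp z h2
  have h4 : joinL p q r J (l + kappa p r I) (restL p q r J _ (0, coordVec _ j k), a) =
      c • (0, coordVec _ j k) + ∑ j' : J, a j' • (0, coordVec _ (j' : Fin n) (q j' - p r)) := by
    rw [← hc, ← joinL_inr, ← map_add]
    simp
  simp only [pderivX_eq_fderiv]
  rw [h3.fderiv]
  change fderiv ℝ g (substPoint φ z) (joinL p q r J (l + kappa p r I) (restL p q r J _
    (0, coordVec _ j k), a)) = _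
  rw [h4, map_add, map_sum]
  simp only [map_smul, smul_eq_mul]

/-- The new equation does not depend on `x_j^{(k)}` for `k ≥ q_j - p_r`: at the substituted point,
the derivatives of `F_r` in these orders are a combination of those of `F_I^{(p - p_r)}`, which
vanishes identically after the substitution. -/
theorem pderivX_output_eq_zero (hφ : IsExplicitFunction T Ω F p q r I J T' V W φ z₀)
    (hadm : IsAdmissibleTriple T Ω F p q r I J) (hT : IsOpen T) (hΩ : IsOpen Ω)
    (hF : AnalyticOnNhd ℝ F (T ×ˢ Ω)) (hpq : DualFeasible (T ×ˢ Ω) F p q)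
    {z : ℝ × Jet n (l + kappa p r I)} (hz : z ∈ T' ×ˢ outDomain p q r I J V W) {j : Fin n}
    {k : ℤ} (hk : q j - p r ≤ k) :
    pderivX (fun z => output F p q r I J φ z r) j k z = 0 := by
  have hopen := hT.prod hΩ
  have hP := hφ.substPoint_mem hz
  set P := substPoint φ z with hPdef
  have hns : IsNonsingular (sub (systemJacobian F p q (truncL (Nat.le_add_right l _) P)) I J) := by
    rw [← jacobianIJ_eq hopen hF hpq hadm.le hP, hPdef, substPoint_eq]
    exact hφ.nonsingular _ hz.1 _ (rest_mem_of_mem_outDomain hz.2)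
  obtain ⟨u, hu⟩ := exists_row_combination hadm.not_mem hns
    (hadm.not_isNonsingular_insert (truncL_mem hP))
  have hdr : DifferentiableAt ℝ (fun w => F w r) (truncL (Nat.le_add_right l _) P) :=
    (analyticOnNhd_component hF r _ (truncL_mem hP)).differentiableAt
  -- for `k = q_j - p_r` this is the relation between the rows of `D`; for larger `k`, both sides
  -- vanish by dual feasibility
  have hcomb : ∀ (j : Fin n) (k : ℤ), q j - p r ≤ k →
      pderivX (fun w => F (truncL (Nat.le_add_right l _) w) r) j k P =
        ∑ i : I, u i * pderivX (diffI F p r I i) j k P := by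
    intro j k hk
    rw [pderivX_comp_truncL (f := fun w => F w r) (Nat.le_add_right l _) hdr]
    simp only [fun i => pderivX_diffI hopen hF hpq hadm.le i hk hP]
    rcases hk.eq_or_lt with rfl | hk
    · refine (hu j).trans (Finset.sum_congr rfl fun i _ => ?_)
      have h1 : q j - p r - (p i - p r) = q j - p i := by ring
      rw [h1]
      rfl
    · rw [hpq.pderivX_eq_zero r j hk (truncL_mem hP)]
      refine (Finset.sum_eq_zero fun i _ => ?_).symm
      rw [hpq.pderivX_eq_zero i j (by omega) (truncL_mem hP), mul_zero]
  obtain ⟨c, a, hca⟩ := hφ.exists_pderivX_comp_substPoint hz j k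
  have hI : ∀ i : I, c * pderivX (diffI F p r I i) j k P +
      ∑ j' : J, a j' * pderivX (diffI F p r I i) j' (q j' - p r) P = 0 := by
    intro i
    rw [← hca _ (analyticOnNhd_diffI hF i _ hP).differentiableAt, pderivX_eq_fderiv]
    have hD : T' ×ˢ outDomain p q r I J V W ∈ 𝓝 z :=
      (hφ.interval.1.prod (isOpen_outDomain hadm hφ.isOpen_V hφ.isOpen_W)).mem_nhds hz
    have h0 : (fun w => diffI F p r I i (substPoint φ w)) =ᶠ[𝓝 z] fun _ => (0 : ℝ) := by
      filter_upwards [hD] with w hw using hφ.diffI_substPoint hw i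
    rw [h0.fderiv_eq]
    simp
  rw [output_self, hca (fun w => F (truncL (Nat.le_add_right l _) w) r)
    (hdr.comp P (truncL _).differentiableAt), ← hPdef, hcomb j k hk]
  simp only [fun j' : J => hcomb j' _ le_rfl, Finset.mul_sum]
  rw [Finset.sum_comm, ← Finset.sum_add_distrib]
  refine Finset.sum_eq_zero fun i _ => ?_
  have := congrArg (u i * ·) (hI i)
  simp only [mul_add, Finset.mul_sum, mul_zero] at this
  rw [← this]
  congr 1
  · ring
  · exact Finset.sum_congr rfl fun j' _ => by ring

/-- Raising `p_r` by one keeps `(p, q)` feasible for the output system. -/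
theorem dualFeasible_output (hφ : IsExplicitFunction T Ω F p q r I J T' V W φ z₀)
    (hadm : IsAdmissibleTriple T Ω F p q r I J) (hT : IsOpen T) (hΩ : IsOpen Ω)
    (hF : AnalyticOnNhd ℝ F (T ×ˢ Ω)) (hpq : DualFeasible (T ×ˢ Ω) F p q) :
    DualFeasible (T' ×ˢ outDomain p q r I J V W) (output F p q r I J φ)
      (Function.update p r (p r + 1)) q := by
  rw [dualFeasible_iff]
  rintro i j k ⟨z, hz, hne⟩
  by_contra hk
  refine hne ?_
  by_cases hi : i = r
  · subst hi
    rw [Function.update_self] at hk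
    exact hφ.pderivX_output_eq_zero hadm hT hΩ hF hpq hz (by omega)
  · rw [Function.update_of_ne hi] at hk
    have hmem := truncL_mem (prod_mono hφ.subset_T hφ.subset_Ω hz)
    rw [output_of_ne hi, pderivX_comp_truncL (f := fun w => F w i) (Nat.le_add_right l _)
      (analyticOnNhd_component hF i _ hmem).differentiableAt]
    exact hpq.pderivX_eq_zero i j (by omega) hmem

theorem optValue_output_add_one_le (hφ : IsExplicitFunction T Ω F p q r I J T' V W φ z₀)
    (hadm : IsAdmissibleTriple T Ω F p q r I J) (hT : IsOpen T) (hΩ : IsOpen Ω)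
    (hF : AnalyticOnNhd ℝ F (T ×ˢ Ω)) (hpq : DualOptimal (T ×ˢ Ω) F p q) :
    optValue (T' ×ˢ outDomain p q r I J V W) (output F p q r I J φ) + 1 ≤
      optValue (T ×ˢ Ω) F := by
  have h1 := optValue_le (hφ.dualFeasible_output hadm hT hΩ hF hpq.1)
  have h2 : dualValue (Function.update p r (p r + 1)) q + 1 = dualValue p q := by
    unfold dualValue
    have h3 := Finset.sum_update_of_mem (Finset.mem_univ r) p (p r + 1)
    have h4 := Finset.add_sum_erase Finset.univ p (Finset.mem_univ r)
    rw [Finset.erase_eq] at h4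
    linarith
  rw [optValue_eq hpq, ← h2]
  exact (add_le_add_left h1 1).trans_eq rfl

end IsExplicitFunction

end Substitution

end DAE

theorem mainTheorem1 (n l : ℕ) (T : Set ℝ) (Ω : Set (DAE.Jet n l))
    (F : ℝ × DAE.Jet n l → Fin n → ℝ)
    (hT : DAE.IsOpenInterval T) (hT_ne : T.Nonempty) (hΩ : IsOpen Ω) (hΩ_ne : Ω.Nonempty)
    (hF : AnalyticOnNhd ℝ F (T ×ˢ Ω))
    (hI1 : DAE.HasPerfectMatching (T ×ˢ Ω) F) :
    -- a dual optimal solution with entries in `[0, nl]` exists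
    (∃ p q : Fin n → ℤ, DAE.DualOptimal (T ×ˢ Ω) F p q ∧
      ∀ i, 0 ≤ p i ∧ p i ≤ n * l ∧ 0 ≤ q i ∧ q i ≤ n * l) ∧
    -- the method, run with any dual optimal solution that satisfies the assumptions
    ∀ p q : Fin n → ℤ, DAE.DualOptimal (T ×ˢ Ω) F p q →
      DAE.ConsistencyAssumption (T ×ˢ Ω) F p q →
      (∀ z ∈ T ×ˢ Ω, ¬ DAE.IsNonsingular (DAE.systemJacobian F p q z)) →
      (∃ r I J, DAE.IsAdmissibleTriple T Ω F p q r I J) ∧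
      ∀ r I J, DAE.IsAdmissibleTriple T Ω F p q r I J →
        ((∀ i, 0 ≤ p i ∧ p i ≤ n * l ∧ 0 ≤ q i ∧ q i ≤ n * l) →
          DAE.kappa p r I ≤ l * n) ∧
        (∃ z, DAE.IsBasePoint T Ω F p q r I J z) ∧
        ∀ z, DAE.IsBasePoint T Ω F p q r I J z →
          (∃ T' V W φ, DAE.IsExplicitFunction T Ω F p q r I J T' V W φ z) ∧
          ∀ T' V W φ, DAE.IsExplicitFunction T Ω F p q r I J T' V W φ z →
            -- the output is real analytic on a nonempty open set
            (DAE.IsOpenInterval T' ∧ T'.Nonempty ∧ T' ⊆ T ∧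
              IsOpen (DAE.outDomain p q r I J V W) ∧ (DAE.outDomain p q r I J V W).Nonempty ∧
              DAE.outDomain p q r I J V W ⊆ DAE.prolong Ω (DAE.kappa p r I) ∧
              AnalyticOnNhd ℝ (DAE.output F p q r I J φ)
                (T' ×ˢ DAE.outDomain p q r I J V W)) ∧
            -- the output is locally equivalent to the input
            DAE.LocallyEquivalent T Ω F T' (DAE.outDomain p q r I J V W)
              (DAE.output F p q r I J φ) ∧
            -- the optimal value of the assignment problem drops by at least one
            DAE.optValue (T' ×ˢ DAE.outDomain p q r I J V W) (DAE.output F p q r I J φ) + 1 ≤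
              DAE.optValue (T ×ˢ Ω) F := by
  have hopen : IsOpen (T ×ˢ Ω) := hT.1.prod hΩ
  refine ⟨DAE.exists_dualOptimal_bounded hI1, fun p q hpq hcons hsing =>
    ⟨DAE.exists_isAdmissibleTriple (hT_ne.prod hΩ_ne) hsing, fun r I J hadm => ⟨fun hb => ?_,
      DAE.exists_isBasePoint hopen hF hpq.1 hcons hadm, fun z hz =>
        ⟨DAE.exists_isExplicitFunction hT.1 hΩ hF hz, fun T' V W φ hφ => ⟨⟨hφ.interval,
          ⟨_, hφ.mem_T⟩, hφ.subset_T, DAE.isOpen_outDomain hadm hφ.isOpen_V hφ.isOpen_W,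
          ⟨_, _, hφ.mem_V, _, hφ.mem_W, rfl⟩, hφ.subset_Ω, hφ.analyticOnNhd_output hF⟩,
          hφ.locallyEquivalent_output hadm hF,
          hφ.optValue_output_add_one_le hadm hT.1 hΩ hF hpq⟩⟩⟩⟩⟩
  have := DAE.kappa_le (r := r) (I := I) fun i => ⟨(hb i).1, (hb i).2.1⟩
  rw [mul_comm]
  exact_mod_cast this
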